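/- All curves are regular plane curves of class $C^2$; $\tau=\sigma_x/|\sigma_x|$ is the unit tangent, $\nu$ is its counterclockwise rotation by $\pi/2$, and $k=\langle\sigma_{xx},\nu\rangle/|\sigma_x|^2$ is the curvature. A complete embedded triod without end points consists of three injective curves $\sigma^i:[0,\infty)\to\mathbb R^2$, each of infinite length, that meet each other exactly at a common initial point (the 3-point), where their unit tangents satisfy $\tau^1+\tau^2+\tau^3=0$ (angles of $120$ degrees). A complete embedded curve without end points is an injective curve $\mathbb R\to\mathbb R^2$ of infinite length in both directions; a complete embedded curve with one end point is an injective curve $[0,\infty)\to\mathbb R^2$ of infinite length. (Closed, unbounded, properly embedded triods and curves are complete in this sense.) **Shrinkers.** Suppose $k=-\langle x,\nu\rangle$ at every point $x$. 1. If a complete embedded triod without end points satisfies this equation, then its 3-point is the origin and its three curves are half-lines from the origin forming angles of $120$ degrees; in particular $k\equiv0$. 2. If a complete embedded curve without end points satisfies it, then it is a straight line through the origin; in particular $k\equiv0$. 3. If a complete embedded curve with one end point satisfies it, then it is a half-line (contained in a line through the origin); in particular $k\equiv0$. **Flows.** Let $I\subset\mathbb R$ be an interval with more than one point and let $(\mathbb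 T_t)_{t\in I}$ be a family of complete embedded triods without end points, or of complete embedded curves with no or with one end point, that flows by curvature: locally in space and time it is parametrized by embedded arcs $\gamma(\cdot,t)$ (around a 3-point, by embedded triods) whose points have a velocity $\gamma_t$ with $\langle\gamma_t,\nu\rangle=k$. Suppose that it shrinks homothetically around a point $c$: there is a differentiable, strictly decreasing $r:I\to(0,\infty)$ with $\mathbb T_t=c+\frac{r(t)}{r(s)}(\mathbb T_s-c)$ for all $s,t\in I$. Then $k\equiv0$ on every $\mathbb T_t$, and: 1. for triods, $\mathbb T_t$ is, for all $t\in I$, one and the same union of three half-lines from $c$ forming angles of $120$ degrees, and its 3-point is $c$; 2. for curves without end points, $\mathbb T_t$ is, for all $t\in I$, one and the same straight line through $c$; 3. for curves with one end point, every $\mathbb T_t$ is a half-line, with a direction independent of $t$, contained in a line through $c$; if the end point is kept fixed during the flow, then $\mathbb T_t$ is, for all $t\in I$, one and the same half-line from $c$. -/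

import Mathlib

open Set

/-- The Euclidean plane. -/
abbrev Plane := EuclideanSpace ℝ (Fin 2)

noncomputable section

/-- Counterclockwise rotation by `π / 2`. -/
def rot (v : Plane) : Plane := !₂[-v 1, v 0]

/-! Curves are maps `σ : ℝ → Plane` restricted to a domain `D` (an interval); all derivatives are
taken within `D`, hence one-sided at the end points of `D`. -/

/-- `σ_x`. -/
def vel (σ : ℝ → Plane) (D : Set ℝ) (x : ℝ) : Plane := derivWithin σ D x

/-- `σ_xx`. -/
def acc (σ : ℝ → Plane) (D : Set ℝ) (x : ℝ) : Plane := derivWithin (vel σ D) D x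

/-- The unit tangent `τ = σ_x / |σ_x|`. -/
def tangent (σ : ℝ → Plane) (D : Set ℝ) (x : ℝ) : Plane := ‖vel σ D x‖⁻¹ • vel σ D x

/-- The unit normal `ν`, the rotation of `τ` by `π / 2`. -/
def normal (σ : ℝ → Plane) (D : Set ℝ) (x : ℝ) : Plane := rot (tangent σ D x)

/-- The curvature `k = ⟨σ_xx | ν⟩ / |σ_x|²`. -/
def curvature (σ : ℝ → Plane) (D : Set ℝ) (x : ℝ) : ℝ :=
  inner ℝ (acc σ D x) (normal σ D x) / ‖vel σ D x‖ ^ 2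

/-- A regular curve of class `C²` on `D`. -/
def IsRegularCurve (σ : ℝ → Plane) (D : Set ℝ) : Prop :=
  ContDiffOn ℝ 2 σ D ∧ ∀ x ∈ D, vel σ D x ≠ 0

/-- The shrinker equation `k = -⟨x | ν⟩` at every point of the curve. -/
def IsShrinker (σ : ℝ → Plane) (D : Set ℝ) : Prop :=
  ∀ x ∈ D, curvature σ D x = -inner ℝ (σ x) (normal σ D x)

/-- A complete embedded curve without end points: regular, without self-intersections and of
infinite length in both directions. -/
structure IsCompleteLine (σ : ℝ → Plane) : Prop where
  regular : IsRegularCurve σ univ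
  injective : Function.Injective σ
  length_right : eVariationOn σ (Ici 0) = ⊤
  length_left : eVariationOn σ (Iic 0) = ⊤

/-- A complete embedded curve with exactly one end point, `σ 0`. -/
structure IsCompleteHalfLine (σ : ℝ → Plane) : Prop where
  regular : IsRegularCurve σ (Ici 0)
  injective : InjOn σ (Ici 0)
  length : eVariationOn σ (Ici 0) = ⊤

/-- The conditions on three curves, parametrized on `D ∋ 0`, to form an embedded triod: each of
them is regular and injective, they meet exactly at the common initial point (the 3-point), and
there they form angles of 120 degrees. -/
structure IsTriodOn (σ : Fin 3 → ℝ → Plane) (D : Set ℝ) : Prop where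
  regular : ∀ i, IsRegularCurve (σ i) D
  injective : ∀ i, InjOn (σ i) D
  common : ∀ i j, σ i 0 = σ j 0
  meet : ∀ i j, i ≠ j → ∀ x ∈ D, ∀ y ∈ D, σ i x = σ j y → x = 0 ∧ y = 0
  angles : ∑ i, tangent (σ i) D 0 = 0

/-- A complete embedded triod without end points: its three edges, parametrized on `[0, ∞)`, have
infinite length. -/
structure IsCompleteTriod (σ : Fin 3 → ℝ → Plane) : Prop where
  triod : IsTriodOn σ (Ici 0)
  length : ∀ i, eVariationOn (σ i) (Ici 0) = ⊤

/-- The subset of the plane covered by a triod. -/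
def triodSet (σ : Fin 3 → ℝ → Plane) : Set Plane := ⋃ i, σ i '' Ici 0

/-- The closed half-line from `p` in the direction `v`. -/
def ray (p v : Plane) : Set Plane := (fun s : ℝ => p + s • v) '' Ici 0

/-- The straight line through `p` in the direction `v`. -/
def straightLine (p v : Plane) : Set Plane := range (fun s : ℝ => p + s • v)

/-- The three unit vectors `v i` form angles of 120 degrees with each other. -/
def Angles120 (v : Fin 3 → Plane) : Prop :=
  (∀ i, ‖v i‖ = 1) ∧
    ∀ i j, i ≠ j → InnerProductGeometry.angle (v i) (v j) = 2 * Real.pi / 3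

/-- The curves `γ · t`, `t ∈ J`, parametrized on `D`, move by curvature: the points have a velocity,
whose normal component is the curvature. The tangential component is free, so that in particular
the evolution `γ_t = γ_xx / |γ_x|²` is covered. -/
def MovesByCurvature (γ : ℝ → ℝ → Plane) (D J : Set ℝ) : Prop :=
  ∀ t ∈ J, ∀ x ∈ D, ∃ w : Plane, HasDerivWithinAt (fun s => γ x s) w J t ∧
    inner ℝ w (normal (fun y => γ y t) D x) = curvature (fun y => γ y t) D x

/-- The times of `I` at distance less than `ε` from `t₀`. -/
def timesNear (I : Set ℝ) (t₀ ε : ℝ) : Set ℝ := I ∩ Ioo (t₀ - ε) (t₀ + ε)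

/-- Around the space-time point `(p, t₀)`, the sets `T t`, `t ∈ I`, are parametrized by a family of
embedded arcs moving by curvature and having `p` in the interior of the arc at the time `t₀`. The
end points of the arcs are free to move. -/
def IsCurveFlowNear (T : ℝ → Set Plane) (I : Set ℝ) (t₀ : ℝ) (p : Plane) : Prop :=
  ∃ (U : Set Plane) (ε : ℝ) (γ : ℝ → ℝ → Plane), IsOpen U ∧ p ∈ U ∧ 0 < ε ∧
    p ∈ (fun x => γ x t₀) '' Ioo (-1) 1 ∧
    (∀ t ∈ timesNear I t₀ ε,
      IsRegularCurve (fun x => γ x t) (Icc (-1) 1) ∧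
      InjOn (fun x => γ x t) (Icc (-1) 1) ∧
      T t ∩ U ⊆ (fun x => γ x t) '' Icc (-1) 1 ∧
      (fun x => γ x t) '' Icc (-1) 1 ⊆ T t) ∧
    MovesByCurvature γ (Icc (-1) 1) (timesNear I t₀ ε)

/-- Around the space-time point `(p, t₀)`, the sets `T t`, `t ∈ I`, are parametrized by a family of
embedded arcs moving by curvature, `γ 0 t₀ = p`, and `γ 0 t` is the end point `P t`. -/
def IsEndPointFlowNear (T : ℝ → Set Plane) (P : ℝ → Plane) (I : Set ℝ) (t₀ : ℝ) (p : Plane) :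
    Prop :=
  ∃ (U : Set Plane) (ε : ℝ) (γ : ℝ → ℝ → Plane), IsOpen U ∧ p ∈ U ∧ 0 < ε ∧
    γ 0 t₀ = p ∧
    (∀ t ∈ timesNear I t₀ ε,
      IsRegularCurve (fun x => γ x t) (Icc 0 1) ∧
      InjOn (fun x => γ x t) (Icc 0 1) ∧
      γ 0 t = P t ∧
      T t ∩ U ⊆ (fun x => γ x t) '' Icc 0 1 ∧
      (fun x => γ x t) '' Icc 0 1 ⊆ T t) ∧
    MovesByCurvature γ (Icc 0 1) (timesNear I t₀ ε)

/-- Around the space-time point `(p, t₀)`, the sets `T t`, `t ∈ I`, are parametrized by a family of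
embedded triods (with end points free to move) whose edges move by curvature and whose 3-point at
the time `t₀` is `p`. -/
def IsTriodFlowNear (T : ℝ → Set Plane) (I : Set ℝ) (t₀ : ℝ) (p : Plane) : Prop :=
  ∃ (U : Set Plane) (ε : ℝ) (γ : Fin 3 → ℝ → ℝ → Plane), IsOpen U ∧ p ∈ U ∧ 0 < ε ∧
    (∀ i, γ i 0 t₀ = p) ∧
    (∀ t ∈ timesNear I t₀ ε,
      IsTriodOn (fun i x => γ i x t) (Icc 0 1) ∧
      T t ∩ U ⊆ ⋃ i, (fun x => γ i x t) '' Icc 0 1 ∧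
      (⋃ i, (fun x => γ i x t) '' Icc 0 1) ⊆ T t) ∧
    ∀ i, MovesByCurvature (γ i) (Icc 0 1) (timesNear I t₀ ε)

/-- The complete embedded triods without end points given by `σ t`, `t ∈ I`, flow by curvature. The
parametrizations `σ t` of the single triods are not related to each other; the flow is expressed by
local parametrizations in space and time. -/
structure IsTriodFlow (σ : ℝ → Fin 3 → ℝ → Plane) (I : Set ℝ) : Prop where
  slice : ∀ t ∈ I, IsCompleteTriod (σ t)
  edges : ∀ t ∈ I, ∀ i, ∀ x > 0, IsCurveFlowNear (fun s => triodSet (σ s)) I t (σ t i x)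
  junction : ∀ t ∈ I, IsTriodFlowNear (fun s => triodSet (σ s)) I t (σ t 0 0)

/-- The complete embedded curves without end points given by `σ t`, `t ∈ I`, flow by curvature. -/
structure IsLineFlow (σ : ℝ → ℝ → Plane) (I : Set ℝ) : Prop where
  slice : ∀ t ∈ I, IsCompleteLine (σ t)
  points : ∀ t ∈ I, ∀ x, IsCurveFlowNear (fun s => range (σ s)) I t (σ t x)

/-- The complete embedded curves with one end point given by `σ t`, `t ∈ I`, flow by curvature. The
end point `σ t 0` is allowed to move. -/
structure IsHalfLineFlow (σ : ℝ → ℝ → Plane) (I : Set ℝ) : Prop where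
  slice : ∀ t ∈ I, IsCompleteHalfLine (σ t)
  points : ∀ t ∈ I, ∀ x > 0, IsCurveFlowNear (fun s => σ s '' Ici 0) I t (σ t x)
  endPoint : ∀ t ∈ I, IsEndPointFlowNear (fun s => σ s '' Ici 0) (fun s => σ s 0) I t (σ t 0)

/-- The sets `T t`, `t ∈ I`, shrink homothetically around `c`. -/
def ShrinksHomothetically (T : ℝ → Set Plane) (I : Set ℝ) (c : Plane) : Prop :=
  ∃ r : ℝ → ℝ, (∀ t ∈ I, 0 < r t) ∧ DifferentiableOn ℝ r I ∧ StrictAntiOn r I ∧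
    ∀ s ∈ I, ∀ t ∈ I, T t = AffineMap.homothety c (r t / r s) '' T s

end

/-!
Along a curve satisfying `k = -lam * ⟨x - c | ν⟩` with `lam > 0`, the product of `k` and
`exp (-lam * |x - c| ^ 2 / 2)` is constant, so that `k` either vanishes identically or has a fixed
sign and `|k|` is bounded from below. In the second case, the turning angle of a complete curve
tends to infinity. As a function of that angle, `|k| - √lam` satisfies an oscillation equation and
changes sign infinitely often. Hence `|k|` has critical points on both sides of `√lam`, at which
`|x - c|` attains its maximum and its minimum. The polar angle around `c` thus tends to infinity as
well, and after a full turn the distance from `c` cannot always have increased, nor always have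
decreased: the curve meets itself. So `k = 0` and the curve is straight, and contained in a line
through `c`. For the three edges of a triod, this forces the 3-point to be `c`.

A flow shrinking around `c` with the scale `r` satisfies `k = (r' / r) * ⟨x - c | ν⟩` at each
time, and `r' < 0` at some time because `r` is strictly decreasing. At that time the shape is
known, and the homotheties carry it to all other times.
-/

section RealAnalysis

open Filter Topology

theorem eq_of_hasDerivWithinAt_zero {E : Type*} [NormedAddCommGroup E] [NormedSpace ℝ E]
    {f : ℝ → E} {D : Set ℝ} (hD : Convex ℝ D) (hf : ∀ x ∈ D, HasDerivWithinAt f 0 D x) {x y : ℝ}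
    (hx : x ∈ D) (hy : y ∈ D) : f x = f y := by
  have h := hD.norm_image_sub_le_of_norm_hasDerivWithin_le (C := 0) hf (by simp) hy hx
  rwa [zero_mul, norm_le_zero_iff, sub_eq_zero] at h

theorem monotoneOn_of_hasDerivWithinAt {f f' : ℝ → ℝ} {D : Set ℝ} (hD : Convex ℝ D)
    (hf : ∀ x ∈ D, HasDerivWithinAt f (f' x) D x) (hf' : ∀ x ∈ D, 0 ≤ f' x) : MonotoneOn f D :=
  monotoneOn_of_hasDerivWithinAt_nonneg hD (fun x hx => (hf x hx).continuousWithinAt)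
    (fun x hx => (hf x (interior_subset hx)).mono interior_subset)
    fun x hx => hf' x (interior_subset hx)

theorem strictMonoOn_of_hasDerivWithinAt {f f' : ℝ → ℝ} {D : Set ℝ} (hD : Convex ℝ D)
    (hf : ∀ x ∈ D, HasDerivWithinAt f (f' x) D x) (hf' : ∀ x ∈ D, 0 < f' x) : StrictMonoOn f D :=
  strictMonoOn_of_hasDerivWithinAt_pos hD (fun x hx => (hf x hx).continuousWithinAt)
    (fun x hx => (hf x (interior_subset hx)).mono interior_subset)
    fun x hx => hf' x (interior_subset hx)

theorem hasDerivWithinAt_integral {f : ℝ → ℝ} {D : Set ℝ} (hclosed : IsClosed D)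
    (hconv : Convex ℝ D) (hf : ContinuousOn f D) {a x : ℝ} (ha : a ∈ D) (hx : x ∈ D) :
    HasDerivWithinAt (fun y => ∫ t in a..y, f t) (f x) D x := by
  obtain ⟨g, hg⟩ := ContinuousMap.exists_restrict_eq hclosed ⟨D.domRestrict f, hf.domRestrict⟩
  have hgf : EqOn g f D := fun y hy => DFunLike.congr_fun hg ⟨y, hy⟩
  rw [← hgf hx]
  refine (g.continuous.integral_hasStrictDerivAt a x).hasDerivAt.hasDerivWithinAt.congr_of_mem
    (fun y hy => intervalIntegral.integral_congr ?_) hx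
  exact fun t ht => (hgf (hconv.ordConnected.uIcc_subset ha hy ht)).symm

theorem tendsto_atTop_of_mul_deriv_le {L L' F F' : ℝ → ℝ} {δ t₀ : ℝ} (hδ : 0 < δ)
    (hL : ∀ x ∈ Ici t₀, HasDerivWithinAt L (L' x) (Ici t₀) x)
    (hF : ∀ x ∈ Ici t₀, HasDerivWithinAt F (F' x) (Ici t₀) x)
    (hle : ∀ x ∈ Ici t₀, δ * L' x ≤ F' x) (hLtop : Tendsto L atTop atTop) :
    Tendsto F atTop atTop := by
  have hmono : MonotoneOn (fun x => F x - δ * L x) (Ici t₀) :=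
    monotoneOn_of_hasDerivWithinAt (convex_Ici t₀)
      (fun x hx => (hF x hx).sub ((hL x hx).const_mul δ)) fun x hx => sub_nonneg.2 (hle x hx)
  refine tendsto_atTop_mono' atTop ?_
    (tendsto_atTop_add_const_right atTop (F t₀ - δ * L t₀) (hLtop.const_mul_atTop hδ))
  filter_upwards [eventually_ge_atTop t₀] with x hx
  linarith [hmono self_mem_Ici hx hx]

theorem eVariationOn_le_of_dist_le {α E : Type*} [LinearOrder α] [PseudoMetricSpace E]
    {f : α → E} {g : α → ℝ} {s : Set α}
    (h : ∀ a ∈ s, ∀ b ∈ s, a ≤ b → dist (f a) (f b) ≤ g b - g a) :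
    eVariationOn f s ≤ eVariationOn g s := by
  refine iSup_le fun p => le_trans (Finset.sum_le_sum fun i _ => ?_) (eVariationOn.sum_le
    p.2.2.1 p.2.2.2)
  rw [edist_comm, edist_dist, edist_comm, edist_dist, Real.dist_eq, abs_sub_comm]
  exact ENNReal.ofReal_le_ofReal
    ((h _ (p.2.2.2 i) _ (p.2.2.2 (i + 1)) (p.2.2.1 i.le_succ)).trans (le_abs_self _))

theorem exists_lt_sub_of_eVariationOn_eq_top {α E : Type*} [LinearOrder α] [PseudoMetricSpace E]
    {f : α → E} {g : α → ℝ} {s : Set α}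
    (h : ∀ a ∈ s, ∀ b ∈ s, a ≤ b → dist (f a) (f b) ≤ g b - g a)
    (hf : eVariationOn f s = ⊤) (M : ℝ) :
    ∃ a ∈ s, ∃ b ∈ s, M < g b - g a := by
  obtain ⟨a, ha, b, hb, -, hab⟩ := eVariationOn.exists_lt_eVariationOn_inter_Icc
    (ENNReal.ofReal_lt_top.trans_eq hf.symm : ENNReal.ofReal M < eVariationOn f s)
  have hmono : MonotoneOn g s := fun a ha b hb hle =>
    sub_nonneg.1 (dist_nonneg.trans (h a ha b hb hle))
  refine ⟨a, ha, b, hb, (ENNReal.ofReal_lt_ofReal_iff'.1 ?_).1⟩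
  calc ENNReal.ofReal M < eVariationOn f (s ∩ Icc a b) := hab
    _ ≤ eVariationOn g (s ∩ Icc a b) :=
      eVariationOn_le_of_dist_le fun x hx y hy => h x hx.1 y hy.1
    _ = ENNReal.ofReal (g b - g a) := hmono.eVariationOn_eq ha hb

theorem image_Ici_eq_Ici {f : ℝ → ℝ} {a : ℝ} (hf : ContinuousOn f (Ici a))
    (hmono : MonotoneOn f (Ici a)) (htop : Tendsto f atTop atTop) : f '' Ici a = Ici (f a) :=
  (image_subset_iff.2 fun _ hx => hmono self_mem_Ici hx hx).antisymm
    (isPreconnected_Ici.intermediate_value_Ici self_mem_Ici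
      (le_principal_iff.2 (Ici_mem_atTop a)) hf htop)

/-- Compare `w` with `sin (θ - θ a)` on a half period by means of their Wronskian. -/
theorem frequently_nonpos_of_oscillation {θ w U ω q : ℝ → ℝ} {t₀ : ℝ}
    (hθ : ∀ x ∈ Ici t₀, HasDerivWithinAt θ (ω x) (Ici t₀) x)
    (hw : ∀ x ∈ Ici t₀, HasDerivWithinAt w (ω x * U x) (Ici t₀) x)
    (hU : ∀ x ∈ Ici t₀, HasDerivWithinAt U (-(ω x * q x * w x)) (Ici t₀) x)
    (hω : ∀ x ∈ Ici t₀, 0 ≤ ω x) (hq : ∀ x ∈ Ici t₀, 1 ≤ q x)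
    (htop : Tendsto θ atTop atTop) : ∃ᶠ x in atTop, w x ≤ 0 := by
  by_contra hpos
  obtain ⟨a₀, ha₀⟩ := eventually_atTop.1 (not_frequently.1 hpos)
  obtain ⟨a, ha0, haw⟩ : ∃ a, t₀ ≤ a ∧ ∀ x ≥ a, 0 < w x :=
    ⟨max a₀ t₀, le_max_right _ _, fun x hx => not_le.1 (ha₀ x (le_of_max_le_left hx))⟩
  have hθmono : MonotoneOn θ (Ici t₀) := monotoneOn_of_hasDerivWithinAt (convex_Ici t₀) hθ hω
  obtain ⟨b, hab, hb⟩ : ∃ b ∈ Ici a, θ b = θ a + Real.pi :=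
    isPreconnected_Ici.intermediate_value_Ici self_mem_Ici
      (le_principal_iff.2 (Ici_mem_atTop a))
      (fun x hx => ((hθ x (ha0.trans hx)).continuousWithinAt.mono (Ici_subset_Ici.2 ha0))) htop
      (by simp [Real.pi_pos.le] : θ a + Real.pi ∈ Ici (θ a))
  have hsub : Icc a b ⊆ Ici t₀ := fun x hx => ha0.trans hx.1
  have hmono : MonotoneOn
      (fun x => w x * Real.cos (θ x - θ a) - U x * Real.sin (θ x - θ a)) (Icc a b) := by
    refine monotoneOn_of_hasDerivWithinAt
      (f' := fun x => ω x * (q x - 1) * w x * Real.sin (θ x - θ a)) (convex_Icc a b)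
      (fun x hx => HasDerivWithinAt.mono ?_ hsub) fun x hx => ?_
    · have hx := hsub hx
      exact (((hw x hx).mul ((hθ x hx).sub_const _).cos).sub
        ((hU x hx).mul ((hθ x hx).sub_const _).sin)).congr_deriv (by ring)
    · have hsin : 0 ≤ Real.sin (θ x - θ a) := Real.sin_nonneg_of_nonneg_of_le_pi
        (sub_nonneg.2 (hθmono ha0 (hsub hx) hx.1))
        (by linarith [hθmono (hsub hx) (hsub (right_mem_Icc.2 hab)) hx.2])
      exact mul_nonneg (mul_nonneg (mul_nonneg (hω x (hsub hx)) (sub_nonneg.2 (hq x (hsub hx))))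
        (haw x hx.1).le) hsin
  have hW := hmono (left_mem_Icc.2 hab) (right_mem_Icc.2 hab) hab
  simp only [hb, add_sub_cancel_left, Real.sin_pi, Real.cos_pi, sub_self, Real.sin_zero,
    Real.cos_zero] at hW
  linarith [haw a le_rfl, haw b hab]

theorem exists_isLocalMax_of_frequently {f : ℝ → ℝ} {m t₀ : ℝ} (hf : ContinuousOn f (Ici t₀))
    (hle : ∃ᶠ x in atTop, f x ≤ m) (hge : ∃ᶠ x in atTop, m ≤ f x) :
    ∃ z > t₀, m ≤ f z ∧ IsLocalMax f z := by
  obtain ⟨a, ha, hfa⟩ := frequently_atTop.1 hle (t₀ + 1)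
  obtain ⟨b, hab, hfb⟩ := frequently_atTop.1 hge (a + 1)
  obtain ⟨c, hbc, hfc⟩ := frequently_atTop.1 hle (b + 1)
  have hb : b ∈ Ioo a c := ⟨by linarith, by linarith⟩
  obtain ⟨z, hz, hmax⟩ := isCompact_Icc.exists_isMaxOn ⟨b, Ioo_subset_Icc_self hb⟩
    (hf.mono fun x hx => mem_Ici.2 (by linarith [hx.1]) : ContinuousOn f (Icc a c))
  by_cases hz' : z ∈ Ioo a c
  · exact ⟨z, by linarith [hz'.1], hfb.trans (hmax (Ioo_subset_Icc_self hb)),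
      hmax.isLocalMax (Icc_mem_nhds hz'.1 hz'.2)⟩
  · have hfz : f z ≤ m := by
      rcases eq_endpoints_or_mem_Ioo_of_mem_Icc hz with rfl | rfl | h
      exacts [hfa, hfc, absurd h hz']
    exact ⟨b, by linarith [hb.1], hfb, IsMaxOn.isLocalMax
      (fun x hx => (hmax hx).trans (hfz.trans hfb)) (Icc_mem_nhds hb.1 hb.2)⟩

theorem exists_eq_add_and_eq {φ ρ : ℝ → ℝ} {p t₀ u v : ℝ} (hφ : ContinuousOn φ (Ici t₀))
    (hmono : StrictMonoOn φ (Ici t₀)) (htop : Tendsto φ atTop atTop) (hp : 0 ≤ p)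
    (hρ : ContinuousOn ρ (Ici t₀)) (hu : u ∈ Ici t₀) (hmax : IsMaxOn ρ (Ici t₀) u)
    (hv : v ∈ Ici t₀) (hmin : IsMinOn ρ (Ici t₀) v) :
    ∃ x ∈ Ici t₀, ∃ y ∈ Ici t₀, φ y = φ x + p ∧ ρ y = ρ x := by
  obtain ⟨e, he⟩ : ∃ e : Ici t₀ ≃o Ici (φ t₀), ∀ x, (e x : ℝ) = φ x :=
    ⟨(hmono.orderIso φ _).trans
      (OrderIso.setCongr _ _ (image_Ici_eq_Ici hφ hmono.monotoneOn htop)), fun _ => rfl⟩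
  let shift (x : Ici t₀) : Ici t₀ :=
    e.symm ⟨e x + p, (e x).2.trans (le_add_of_nonneg_right hp)⟩
  have hshift : Continuous shift :=
    e.symm.continuous.comp
      (((continuous_subtype_val.comp e.continuous).add_const p).subtype_mk _)
  have hρ' : Continuous fun x : Ici t₀ => ρ x := hρ.domRestrict
  have : PreconnectedSpace (Ici t₀) := Subtype.preconnectedSpace isPreconnected_Ici
  lift u to Ici t₀ using hu
  lift v to Ici t₀ using hv
  obtain ⟨x, hx⟩ := intermediate_value_univ₂ (hρ'.comp hshift) hρ'
    (hmax (shift u).2) (hmin (shift v).2)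
  refine ⟨x, x.2, shift x, (shift x).2, ?_, hx⟩
  rw [← he, ← he, e.apply_symm_apply]

end RealAnalysis

section Plane

theorem plane_ext {a b : Plane} (h0 : a 0 = b 0) (h1 : a 1 = b 1) : a = b := by
  ext i; fin_cases i <;> assumption

theorem inner_plane (a b : Plane) : inner ℝ a b = a 0 * b 0 + a 1 * b 1 := by
  simp [PiLp.inner_apply, Fin.sum_univ_two, mul_comm]

theorem norm_sq_plane (a : Plane) : ‖a‖ ^ 2 = a 0 ^ 2 + a 1 ^ 2 := by
  rw [← real_inner_self_eq_norm_sq, inner_plane]; ring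

@[simp] theorem rot_apply_zero (v : Plane) : rot v 0 = -v 1 := by simp [rot]

@[simp] theorem rot_apply_one (v : Plane) : rot v 1 = v 0 := by simp [rot]

/-- `rot` as a continuous linear map, for use in the linear and differential calculus. -/
noncomputable def rotL : Plane →L[ℝ] Plane :=
  LinearMap.toContinuousLinearMap
    { toFun := rot
      map_add' := fun v w => by apply plane_ext <;> simp [add_comm]
      map_smul' := fun a v => by apply plane_ext <;> simp }

theorem rot_smul (a : ℝ) (v : Plane) : rot (a • v) = a • rot v := rotL.map_smul a v

theorem rot_rot (v : Plane) : rot (rot v) = -v := by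
  apply plane_ext <;> simp

theorem norm_rot (v : Plane) : ‖rot v‖ = ‖v‖ := by
  rw [← sq_eq_sq₀ (norm_nonneg _) (norm_nonneg _), norm_sq_plane, norm_sq_plane, rot_apply_zero,
    rot_apply_one]
  ring

theorem inner_self_rot (v : Plane) : inner ℝ v (rot v) = 0 := by
  rw [inner_plane, rot_apply_zero, rot_apply_one]; ring

theorem inner_rot_right (v w : Plane) : inner ℝ v (rot w) = -inner ℝ w (rot v) := by
  simp only [inner_plane, rot_apply_zero, rot_apply_one]; ring

theorem eq_inner_smul_add_inner_rot_smul {v : Plane} (hv : ‖v‖ = 1) (a : Plane) :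
    a = inner ℝ a v • v + inner ℝ a (rot v) • rot v := by
  have h := norm_sq_plane v
  rw [hv] at h
  apply plane_ext <;>
    simp only [inner_plane, PiLp.add_apply, PiLp.smul_apply, smul_eq_mul, rot_apply_zero,
      rot_apply_one]
  · linear_combination a 0 * h
  · linear_combination a 1 * h

theorem norm_sq_eq_inner_sq_add_inner_rot_sq {v : Plane} (hv : ‖v‖ = 1) (a : Plane) :
    ‖a‖ ^ 2 = inner ℝ a v ^ 2 + inner ℝ a (rot v) ^ 2 := by
  have h := norm_sq_plane v
  rw [hv] at h
  simp only [norm_sq_plane, inner_plane, rot_apply_zero, rot_apply_one]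
  linear_combination (a 0 ^ 2 + a 1 ^ 2) * h

variable {f : ℝ → Plane} {D : Set ℝ} {x y : ℝ}

theorem hasDerivWithinAt_rot {f' : Plane} (hf : HasDerivWithinAt f f' D x) :
    HasDerivWithinAt (fun y => rot (f y)) (rot f') D x :=
  rotL.hasFDerivAt.comp_hasDerivWithinAt x hf

theorem hasDerivWithinAt_inv_norm_smul {f' : Plane} (hf : HasDerivWithinAt f f' D x)
    (h0 : f x ≠ 0) : HasDerivWithinAt (fun y => ‖f y‖⁻¹ • f y)
      ((inner ℝ f' (rot (f x)) / ‖f x‖ ^ 2) • rot (‖f x‖⁻¹ • f x)) D x := by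
  have hpos : ‖f x‖ ≠ 0 := norm_ne_zero_iff.2 h0
  have hnorm : HasDerivWithinAt (fun y => ‖f y‖) (inner ℝ (f x) f' / ‖f x‖) D x := by
    have h := hf.norm_sq.sqrt (pow_ne_zero 2 hpos)
    simp only [Real.sqrt_sq (norm_nonneg _)] at h
    exact h.congr_deriv (mul_div_mul_left _ _ two_ne_zero)
  refine ((hnorm.inv hpos).smul hf).congr_deriv ?_
  have hsq := norm_sq_plane (f x)
  apply plane_ext <;>
    simp only [inner_plane, rot_smul, PiLp.add_apply, PiLp.smul_apply, smul_eq_mul, rot_apply_zero,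
      rot_apply_one, Pi.inv_apply] <;> field_simp
  · linear_combination f' 0 * hsq
  · linear_combination f' 1 * hsq

theorem eq_of_hasDerivWithinAt_smul_rot {θ θ' : ℝ → ℝ} (hD : Convex ℝ D)
    (hf : ∀ x ∈ D, HasDerivWithinAt f (θ' x • rot (f x)) D x)
    (hθ : ∀ x ∈ D, HasDerivWithinAt θ (θ' x) D x) (hx : x ∈ D) (hy : y ∈ D)
    (h : (θ x : Real.Angle) = θ y) : f x = f y := by
  have hconst : ∀ x ∈ D, HasDerivWithinAt
      (fun x => Real.cos (θ x) • f x - Real.sin (θ x) • rot (f x)) 0 D x := fun x hx =>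
    (((hθ x hx).cos.smul (hf x hx)).sub
      ((hθ x hx).sin.smul (hasDerivWithinAt_rot (hf x hx)))).congr_deriv (by
        rw [rot_smul, rot_rot]; module)
  have hcos : Real.cos (θ x) = Real.cos (θ y) := congrArg Real.Angle.cos h
  have hsin : Real.sin (θ x) = Real.sin (θ y) := congrArg Real.Angle.sin h
  have heq := eq_of_hasDerivWithinAt_zero hD hconst hx hy
  simp only [hcos, hsin] at heq
  have h0 := congrArg (fun v : Plane => v 0) heq
  have h1 := congrArg (fun v : Plane => v 1) heq
  simp only [PiLp.sub_apply, PiLp.smul_apply, smul_eq_mul, rot_apply_zero, rot_apply_one] at h0 h1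
  have hone := Real.sin_sq_add_cos_sq (θ y)
  apply plane_ext
  · linear_combination Real.cos (θ y) * h0 - Real.sin (θ y) * h1 - (f x 0 - f y 0) * hone
  · linear_combination Real.cos (θ y) * h1 + Real.sin (θ y) * h0 - (f x 1 - f y 1) * hone

end Plane

section RegularCurves

variable {σ : ℝ → Plane} {c : Plane} {D D' : Set ℝ} {x : ℝ}

theorem inner_vel_normal (σ : ℝ → Plane) (D : Set ℝ) (x : ℝ) :
    inner ℝ (vel σ D x) (normal σ D x) = 0 := by
  rw [normal, tangent, rot_smul, inner_smul_right, inner_self_rot, mul_zero]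

namespace IsRegularCurve

theorem hasDerivWithinAt (h : IsRegularCurve σ D) (hx : x ∈ D) :
    HasDerivWithinAt σ (vel σ D x) D x :=
  (h.1.differentiableOn two_ne_zero x hx).hasDerivWithinAt

theorem contDiffOn_vel (h : IsRegularCurve σ D) (hD : UniqueDiffOn ℝ D) :
    ContDiffOn ℝ 1 (vel σ D) D :=
  h.1.derivWithin hD (by norm_num)

theorem hasDerivWithinAt_vel (h : IsRegularCurve σ D) (hD : UniqueDiffOn ℝ D)
    (hx : x ∈ D) : HasDerivWithinAt (vel σ D) (acc σ D x) D x :=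
  ((h.contDiffOn_vel hD).differentiableOn one_ne_zero x hx).hasDerivWithinAt

theorem norm_vel_pos (h : IsRegularCurve σ D) (hx : x ∈ D) : 0 < ‖vel σ D x‖ :=
  norm_pos_iff.2 (h.2 x hx)

theorem norm_tangent (h : IsRegularCurve σ D) (hx : x ∈ D) : ‖tangent σ D x‖ = 1 := by
  rw [tangent, norm_smul, norm_inv, norm_norm, inv_mul_cancel₀ (h.norm_vel_pos hx).ne']

theorem norm_normal (h : IsRegularCurve σ D) (hx : x ∈ D) : ‖normal σ D x‖ = 1 := by
  rw [normal, norm_rot, h.norm_tangent hx]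

theorem norm_smul_tangent (h : IsRegularCurve σ D) (hx : x ∈ D) :
    ‖vel σ D x‖ • tangent σ D x = vel σ D x := by
  rw [tangent, smul_inv_smul₀ (h.norm_vel_pos hx).ne']

theorem inner_acc_normal (h : IsRegularCurve σ D) (hx : x ∈ D) :
    inner ℝ (acc σ D x) (normal σ D x) = curvature σ D x * ‖vel σ D x‖ ^ 2 := by
  rw [curvature, div_mul_cancel₀ _ (pow_ne_zero 2 (h.norm_vel_pos hx).ne')]

theorem continuousOn_norm_vel (h : IsRegularCurve σ D) (hD : UniqueDiffOn ℝ D) :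
    ContinuousOn (fun x => ‖vel σ D x‖) D :=
  (h.contDiffOn_vel hD).continuousOn.norm

theorem continuousOn_normal (h : IsRegularCurve σ D) (hD : UniqueDiffOn ℝ D) :
    ContinuousOn (normal σ D) D :=
  rotL.continuous.comp_continuousOn <|
    ((h.continuousOn_norm_vel hD).inv₀ fun _ hx => (h.norm_vel_pos hx).ne').smul
      (h.contDiffOn_vel hD).continuousOn

theorem continuousOn_curvature (h : IsRegularCurve σ D) (hD : UniqueDiffOn ℝ D) :
    ContinuousOn (curvature σ D) D :=
  (((h.contDiffOn_vel hD).continuousOn_derivWithin hD le_rfl).inner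
    (h.continuousOn_normal hD)).div ((h.continuousOn_norm_vel hD).pow 2)
    fun _ hx => pow_ne_zero 2 (h.norm_vel_pos hx).ne'

theorem vel_of_subset (h : IsRegularCurve σ D) (hD' : UniqueDiffOn ℝ D') (hsub : D' ⊆ D) :
    EqOn (vel σ D') (vel σ D) D' := fun x hx =>
  derivWithin_subset hsub (hD' x hx) (h.hasDerivWithinAt (hsub hx)).differentiableWithinAt

theorem of_subset (h : IsRegularCurve σ D) (hD' : UniqueDiffOn ℝ D') (hsub : D' ⊆ D) :
    IsRegularCurve σ D' :=
  ⟨h.1.mono hsub, fun x hx => by rw [h.vel_of_subset hD' hsub hx]; exact h.2 x (hsub hx)⟩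

theorem normal_of_subset (h : IsRegularCurve σ D) (hD' : UniqueDiffOn ℝ D') (hsub : D' ⊆ D) :
    EqOn (normal σ D') (normal σ D) D' := fun x hx => by
  simp only [normal, tangent, h.vel_of_subset hD' hsub hx]

theorem acc_of_subset (h : IsRegularCurve σ D) (hD : UniqueDiffOn ℝ D) (hD' : UniqueDiffOn ℝ D')
    (hsub : D' ⊆ D) : EqOn (acc σ D') (acc σ D) D' := fun x hx => by
  rw [acc, derivWithin_congr (h.vel_of_subset hD' hsub) (h.vel_of_subset hD' hsub hx)]
  exact ((h.hasDerivWithinAt_vel hD (hsub hx)).mono hsub).derivWithin (hD' x hx)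

theorem curvature_of_subset (h : IsRegularCurve σ D) (hD : UniqueDiffOn ℝ D)
    (hD' : UniqueDiffOn ℝ D') (hsub : D' ⊆ D) : EqOn (curvature σ D') (curvature σ D) D' :=
  fun x hx => by
    simp only [curvature, h.vel_of_subset hD' hsub hx, h.normal_of_subset hD' hsub hx,
      h.acc_of_subset hD hD' hsub hx]

theorem hasDerivWithinAt_tangent (h : IsRegularCurve σ D) (hD : UniqueDiffOn ℝ D) (hx : x ∈ D) :
    HasDerivWithinAt (tangent σ D) ((‖vel σ D x‖ * curvature σ D x) • normal σ D x) D x := by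
  refine (hasDerivWithinAt_inv_norm_smul (h.hasDerivWithinAt_vel hD hx) (h.2 x hx)).congr_deriv ?_
  have : ‖vel σ D x‖ ≠ 0 := (h.norm_vel_pos hx).ne'
  simp only [curvature, normal, tangent, rot_smul, inner_smul_right]
  field_simp

theorem hasDerivWithinAt_normal (h : IsRegularCurve σ D) (hD : UniqueDiffOn ℝ D) (hx : x ∈ D) :
    HasDerivWithinAt (normal σ D) (-(‖vel σ D x‖ * curvature σ D x) • tangent σ D x) D x :=
  (hasDerivWithinAt_rot (h.hasDerivWithinAt_tangent hD hx)).congr_deriv (by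
    rw [rot_smul, normal, rot_rot, smul_neg, neg_smul])

theorem norm_sub_sq (h : IsRegularCurve σ D) (c : Plane) (hx : x ∈ D) :
    ‖σ x - c‖ ^ 2 = inner ℝ (σ x - c) (tangent σ D x) ^ 2 + inner ℝ (σ x - c) (normal σ D x) ^ 2 :=
  norm_sq_eq_inner_sq_add_inner_rot_sq (h.norm_tangent hx) _

theorem hasDerivWithinAt_norm_sub_sq (h : IsRegularCurve σ D) (c : Plane) (hx : x ∈ D) :
    HasDerivWithinAt (fun x => ‖σ x - c‖ ^ 2)
      (2 * (‖vel σ D x‖ * inner ℝ (σ x - c) (tangent σ D x))) D x := by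
  refine ((h.hasDerivWithinAt hx).sub_const c).norm_sq.congr_deriv ?_
  rw [← real_inner_smul_right _ (tangent σ D x), h.norm_smul_tangent hx]

theorem hasDerivWithinAt_inner_sub_tangent (h : IsRegularCurve σ D) (hD : UniqueDiffOn ℝ D)
    (c : Plane) (hx : x ∈ D) : HasDerivWithinAt (fun x => inner ℝ (σ x - c) (tangent σ D x))
      (‖vel σ D x‖ * (1 + curvature σ D x * inner ℝ (σ x - c) (normal σ D x))) D x := by
  refine (((h.hasDerivWithinAt hx).sub_const c).inner ℝ
    (h.hasDerivWithinAt_tangent hD hx)).congr_deriv ?_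
  rw [← h.norm_smul_tangent hx, inner_smul_left, inner_smul_right, real_inner_self_eq_norm_sq,
    h.norm_smul_tangent hx, h.norm_tangent hx, conj_trivial]
  ring

theorem hasDerivWithinAt_inner_sub_normal (h : IsRegularCurve σ D) (hD : UniqueDiffOn ℝ D)
    (c : Plane) (hx : x ∈ D) : HasDerivWithinAt (fun x => inner ℝ (σ x - c) (normal σ D x))
      (-(‖vel σ D x‖ * curvature σ D x * inner ℝ (σ x - c) (tangent σ D x))) D x := by
  refine (((h.hasDerivWithinAt hx).sub_const c).inner ℝ
    (h.hasDerivWithinAt_normal hD hx)).congr_deriv ?_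
  rw [inner_vel_normal, add_zero, inner_smul_right, neg_mul]

end IsRegularCurve

end RegularCurves

section Arclength

open Filter Topology

/-- The signed length of the curve `σ` from the parameter `0` to the parameter `x`. -/
noncomputable def arclength (σ : ℝ → Plane) (D : Set ℝ) (x : ℝ) : ℝ :=
  ∫ t in (0 : ℝ)..x, ‖vel σ D t‖

@[simp] theorem arclength_zero (σ : ℝ → Plane) (D : Set ℝ) : arclength σ D 0 = 0 :=
  intervalIntegral.integral_same

namespace IsRegularCurve

variable {σ : ℝ → Plane} {D : Set ℝ} {a b x y : ℝ}

theorem hasDerivWithinAt_arclength (h : IsRegularCurve σ D) (hclosed : IsClosed D)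
    (hconv : Convex ℝ D) (hD : UniqueDiffOn ℝ D) (h0 : 0 ∈ D) (hx : x ∈ D) :
    HasDerivWithinAt (arclength σ D) ‖vel σ D x‖ D x :=
  hasDerivWithinAt_integral hclosed hconv (h.continuousOn_norm_vel hD) h0 hx

theorem monotoneOn_arclength (h : IsRegularCurve σ D) (hclosed : IsClosed D) (hconv : Convex ℝ D)
    (hD : UniqueDiffOn ℝ D) (h0 : 0 ∈ D) : MonotoneOn (arclength σ D) D :=
  monotoneOn_of_hasDerivWithinAt hconv
    (fun _ hx => h.hasDerivWithinAt_arclength hclosed hconv hD h0 hx) fun _ _ => norm_nonneg _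

theorem dist_le_arclength_sub (h : IsRegularCurve σ D) (hclosed : IsClosed D) (hconv : Convex ℝ D)
    (hD : UniqueDiffOn ℝ D) (h0 : 0 ∈ D) (ha : a ∈ D) (hb : b ∈ D) (hab : a ≤ b) :
    dist (σ a) (σ b) ≤ arclength σ D b - arclength σ D a := by
  have hsub : Icc a b ⊆ D := hconv.ordConnected.out ha hb
  have hnhds : ∀ x ∈ Ico a b, D ∈ 𝓝[Ici x] x := fun x hx =>
    mem_of_superset (Icc_mem_nhdsGE hx.2) ((Icc_subset_Icc_left hx.1).trans hsub)
  have hL : ∀ x ∈ Icc a b, HasDerivWithinAt (arclength σ D) ‖vel σ D x‖ D x := fun x hx =>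
    h.hasDerivWithinAt_arclength hclosed hconv hD h0 (hsub hx)
  rw [dist_comm, dist_eq_norm]
  refine image_norm_le_of_norm_deriv_right_le_deriv_boundary' (f := fun x => σ x - σ a)
    (f' := vel σ D) (B := fun x => arclength σ D x - arclength σ D a)
    (B' := fun x => ‖vel σ D x‖) ?_ ?_ (by simp) ?_ ?_ (fun _ _ => le_rfl) (right_mem_Icc.2 hab)
  · exact (h.1.continuousOn.mono hsub).sub continuousOn_const
  · exact fun x hx => ((h.hasDerivWithinAt (hsub (Ico_subset_Icc_self hx))).mono_of_mem_nhdsWithin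
      (hnhds x hx)).sub_const _
  · exact fun x hx => ((hL x hx).mono hsub).continuousWithinAt.sub continuousWithinAt_const
  · exact fun x hx =>
      ((hL x (Ico_subset_Icc_self hx)).mono_of_mem_nhdsWithin (hnhds x hx)).sub_const _

theorem tendsto_arclength_atTop (h : IsRegularCurve σ D) (hclosed : IsClosed D)
    (hconv : Convex ℝ D) (hD : UniqueDiffOn ℝ D) (hsub : Ici 0 ⊆ D)
    (hσ : eVariationOn σ (Ici 0) = ⊤) : Tendsto (arclength σ D) atTop atTop := by
  have hmono := (h.monotoneOn_arclength hclosed hconv hD (hsub self_mem_Ici)).mono hsub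
  refine tendsto_atTop.2 fun M => ?_
  obtain ⟨a, ha, b, hb, hM⟩ := exists_lt_sub_of_eVariationOn_eq_top
    (fun a ha b hb => h.dist_le_arclength_sub hclosed hconv hD (hsub self_mem_Ici) (hsub ha)
      (hsub hb)) hσ M
  filter_upwards [eventually_ge_atTop b] with x hx
  have h0a := hmono self_mem_Ici ha ha
  rw [arclength_zero] at h0a
  linarith [hmono hb (mem_Ici.2 (hb.trans hx)) hx]

theorem tendsto_arclength_atBot (h : IsRegularCurve σ D) (hclosed : IsClosed D)
    (hconv : Convex ℝ D) (hD : UniqueDiffOn ℝ D) (hsub : Iic 0 ⊆ D)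
    (hσ : eVariationOn σ (Iic 0) = ⊤) : Tendsto (arclength σ D) atBot atBot := by
  have hmono := (h.monotoneOn_arclength hclosed hconv hD (hsub self_mem_Iic)).mono hsub
  refine tendsto_atBot.2 fun M => ?_
  obtain ⟨a, ha, b, hb, hM⟩ := exists_lt_sub_of_eVariationOn_eq_top
    (fun a ha b hb => h.dist_le_arclength_sub hclosed hconv hD (hsub self_mem_Iic) (hsub ha)
      (hsub hb)) hσ (-M)
  filter_upwards [eventually_le_atBot a] with x hx
  have hb0 := hmono hb self_mem_Iic hb
  rw [arclength_zero] at hb0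
  linarith [hmono (mem_Iic.2 (hx.trans ha)) ha hx]

theorem tangent_eq_of_curvature_eq_zero (h : IsRegularCurve σ D) (hconv : Convex ℝ D)
    (hD : UniqueDiffOn ℝ D) (hk : ∀ x ∈ D, curvature σ D x = 0) (hx : x ∈ D) (hy : y ∈ D) :
    tangent σ D x = tangent σ D y :=
  eq_of_hasDerivWithinAt_zero hconv (fun x hx => (h.hasDerivWithinAt_tangent hD hx).congr_deriv
    (by rw [hk x hx, mul_zero, zero_smul])) hx hy

theorem eq_add_arclength_smul_of_curvature_eq_zero (h : IsRegularCurve σ D) (hclosed : IsClosed D)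
    (hconv : Convex ℝ D) (hD : UniqueDiffOn ℝ D) (h0 : 0 ∈ D)
    (hk : ∀ x ∈ D, curvature σ D x = 0) (hx : x ∈ D) :
    σ x = σ 0 + arclength σ D x • tangent σ D 0 := by
  have hconst : ∀ x ∈ D,
      HasDerivWithinAt (fun x => σ x - arclength σ D x • tangent σ D 0) 0 D x := fun x hx =>
    ((h.hasDerivWithinAt hx).sub ((h.hasDerivWithinAt_arclength hclosed hconv hD h0 hx).smul_const
      _)).congr_deriv (by
        rw [h.tangent_eq_of_curvature_eq_zero hconv hD hk h0 hx, h.norm_smul_tangent hx, sub_self])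
  have heq := eq_of_hasDerivWithinAt_zero hconv hconst hx h0
  rwa [arclength_zero, zero_smul, sub_zero, sub_eq_iff_eq_add] at heq

theorem image_eq_of_curvature_eq_zero (h : IsRegularCurve σ D) (hclosed : IsClosed D)
    (hconv : Convex ℝ D) (hD : UniqueDiffOn ℝ D) (h0 : 0 ∈ D)
    (hk : ∀ x ∈ D, curvature σ D x = 0) :
    σ '' D = (fun s : ℝ => σ 0 + s • tangent σ D 0) '' (arclength σ D '' D) := by
  rw [image_image]
  exact image_congr fun x hx =>
    h.eq_add_arclength_smul_of_curvature_eq_zero hclosed hconv hD h0 hk hx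

end IsRegularCurve

variable {σ : ℝ → Plane}

namespace IsCompleteHalfLine

theorem hasDerivWithinAt_arclength (h : IsCompleteHalfLine σ) {x : ℝ} (hx : x ∈ Ici (0 : ℝ)) :
    HasDerivWithinAt (arclength σ (Ici 0)) ‖vel σ (Ici 0) x‖ (Ici 0) x :=
  h.regular.hasDerivWithinAt_arclength isClosed_Ici (convex_Ici 0) (uniqueDiffOn_Ici 0)
    self_mem_Ici hx

theorem tendsto_arclength (h : IsCompleteHalfLine σ) :
    Tendsto (arclength σ (Ici 0)) atTop atTop :=
  h.regular.tendsto_arclength_atTop isClosed_Ici (convex_Ici 0) (uniqueDiffOn_Ici 0) Subset.rfl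
    h.length

theorem image_arclength (h : IsCompleteHalfLine σ) : arclength σ (Ici 0) '' Ici 0 = Ici 0 := by
  have hmono := h.regular.monotoneOn_arclength isClosed_Ici (convex_Ici 0) (uniqueDiffOn_Ici 0)
    self_mem_Ici
  rw [image_Ici_eq_Ici (fun x hx => (h.hasDerivWithinAt_arclength hx).continuousWithinAt) hmono
    h.tendsto_arclength, arclength_zero]

theorem image_eq_ray (h : IsCompleteHalfLine σ)
    (hk : ∀ x ∈ Ici (0 : ℝ), curvature σ (Ici 0) x = 0) :
    σ '' Ici 0 = ray (σ 0) (tangent σ (Ici 0) 0) := by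
  rw [h.regular.image_eq_of_curvature_eq_zero isClosed_Ici (convex_Ici 0) (uniqueDiffOn_Ici 0)
    self_mem_Ici hk, h.image_arclength, ray]

end IsCompleteHalfLine

namespace IsCompleteLine

theorem surjective_arclength (h : IsCompleteLine σ) :
    Function.Surjective (arclength σ univ) := by
  refine Continuous.surjective (continuousOn_univ.1 fun x hx =>
    (h.regular.hasDerivWithinAt_arclength isClosed_univ convex_univ uniqueDiffOn_univ (mem_univ 0)
      hx).continuousWithinAt) ?_ ?_
  · exact h.regular.tendsto_arclength_atTop isClosed_univ convex_univ uniqueDiffOn_univ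
      (subset_univ _) h.length_right
  · exact h.regular.tendsto_arclength_atBot isClosed_univ convex_univ uniqueDiffOn_univ
      (subset_univ _) h.length_left

theorem range_eq_straightLine (h : IsCompleteLine σ) (hk : ∀ x, curvature σ univ x = 0) :
    range σ = straightLine (σ 0) (tangent σ univ 0) := by
  rw [← image_univ, h.regular.image_eq_of_curvature_eq_zero isClosed_univ convex_univ
    uniqueDiffOn_univ (mem_univ 0) fun x _ => hk x, image_univ, h.surjective_arclength.range_eq,
    image_univ, straightLine]

end IsCompleteLine

end Arclength

section Shrinkers

open Filter Topology

/-- The equation `k = -lam * ⟨x - c | ν⟩` of the curves shrinking homothetically around `c`. -/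
def IsShrinkerAbout (c : Plane) (lam : ℝ) (σ : ℝ → Plane) (D : Set ℝ) : Prop :=
  ∀ x ∈ D, curvature σ D x = -lam * inner ℝ (σ x - c) (normal σ D x)

theorem IsShrinker.isShrinkerAbout {σ : ℝ → Plane} {D : Set ℝ} (h : IsShrinker σ D) :
    IsShrinkerAbout 0 1 σ D := fun x hx => by
  rw [h x hx, sub_zero, neg_one_mul]

namespace IsShrinkerAbout

variable {σ : ℝ → Plane} {c : Plane} {lam : ℝ} {D D' : Set ℝ} {x y z : ℝ}

theorem of_subset (h : IsShrinkerAbout c lam σ D) (hσ : IsRegularCurve σ D)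
    (hD : UniqueDiffOn ℝ D) (hD' : UniqueDiffOn ℝ D') (hsub : D' ⊆ D) :
    IsShrinkerAbout c lam σ D' := fun x hx => by
  rw [hσ.curvature_of_subset hD hD' hsub hx, hσ.normal_of_subset hD' hsub hx, h x (hsub hx)]

theorem hasDerivWithinAt_curvature (h : IsShrinkerAbout c lam σ D) (hσ : IsRegularCurve σ D)
    (hD : UniqueDiffOn ℝ D) (hx : x ∈ D) : HasDerivWithinAt (curvature σ D)
      (‖vel σ D x‖ * curvature σ D x * (lam * inner ℝ (σ x - c) (tangent σ D x))) D x :=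
  (((hσ.hasDerivWithinAt_inner_sub_normal hD c hx).const_mul (-lam)).congr h (h x hx)).congr_deriv
    (by ring)

theorem hasDerivWithinAt_abs_curvature (h : IsShrinkerAbout c lam σ D) (hσ : IsRegularCurve σ D)
    (hD : UniqueDiffOn ℝ D) (hx : x ∈ D) (hne : curvature σ D x ≠ 0) :
    HasDerivWithinAt (fun x => |curvature σ D x|)
      (‖vel σ D x‖ * |curvature σ D x| * (lam * inner ℝ (σ x - c) (tangent σ D x))) D x := by
  refine ((hasDerivAt_abs hne).comp_hasDerivWithinAt x
    (h.hasDerivWithinAt_curvature hσ hD hx)).congr_deriv ?_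
  rw [← sign_mul_self (curvature σ D x)]
  ring

theorem hasDerivWithinAt_mul_inner_sub_tangent (h : IsShrinkerAbout c lam σ D)
    (hσ : IsRegularCurve σ D) (hD : UniqueDiffOn ℝ D) (hx : x ∈ D) :
    HasDerivWithinAt (fun x => lam * inner ℝ (σ x - c) (tangent σ D x))
      (‖vel σ D x‖ * (lam - curvature σ D x ^ 2)) D x :=
  ((hσ.hasDerivWithinAt_inner_sub_tangent hD c hx).const_mul lam).congr_deriv (by
    linear_combination ‖vel σ D x‖ * curvature σ D x * h x hx)

theorem curvature_eq_mul_exp (h : IsShrinkerAbout c lam σ D) (hσ : IsRegularCurve σ D)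
    (hconv : Convex ℝ D) (hD : UniqueDiffOn ℝ D) (hx : x ∈ D) (hy : y ∈ D) :
    curvature σ D y = curvature σ D x *
      Real.exp (lam / 2 * (‖σ y - c‖ ^ 2 - ‖σ x - c‖ ^ 2)) := by
  have hconst : ∀ x ∈ D, HasDerivWithinAt
      (fun y => curvature σ D y * Real.exp (-(lam / 2) * ‖σ y - c‖ ^ 2)) 0 D x := fun x hx =>
    ((h.hasDerivWithinAt_curvature hσ hD hx).mul
      ((hσ.hasDerivWithinAt_norm_sub_sq c hx).const_mul (-(lam / 2))).exp).congr_deriv (by ring)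
  have heq := eq_of_hasDerivWithinAt_zero hconv hconst hx hy
  rw [neg_mul, neg_mul, Real.exp_neg, Real.exp_neg, ← div_eq_mul_inv, ← div_eq_mul_inv,
    div_eq_div_iff (Real.exp_pos _).ne' (Real.exp_pos _).ne'] at heq
  rw [mul_sub, Real.exp_sub, mul_div_assoc', heq, mul_div_cancel_right₀ _ (Real.exp_pos _).ne']

theorem curvature_eq_zero_of_eq_zero (h : IsShrinkerAbout c lam σ D) (hσ : IsRegularCurve σ D)
    (hconv : Convex ℝ D) (hD : UniqueDiffOn ℝ D) (hx : x ∈ D) (hy : y ∈ D)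
    (h0 : curvature σ D x = 0) : curvature σ D y = 0 := by
  rw [h.curvature_eq_mul_exp hσ hconv hD hx hy, h0, zero_mul]

theorem sign_curvature_eq (h : IsShrinkerAbout c lam σ D) (hσ : IsRegularCurve σ D)
    (hconv : Convex ℝ D) (hD : UniqueDiffOn ℝ D) (hx : x ∈ D) (hy : y ∈ D) :
    SignType.sign (curvature σ D y) = SignType.sign (curvature σ D x) := by
  rw [h.curvature_eq_mul_exp hσ hconv hD hx hy, sign_mul, sign_pos (Real.exp_pos _), mul_one]

theorem mul_exp_sub_one_le (h : IsShrinkerAbout c lam σ D) (hσ : IsRegularCurve σ D)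
    (hconv : Convex ℝ D) (hD : UniqueDiffOn ℝ D) (hz : z ∈ D)
    (hcrit : inner ℝ (σ z - c) (tangent σ D z) = 0) (hx : x ∈ D) :
    curvature σ D z ^ 2 * (Real.exp (lam * (‖σ x - c‖ ^ 2 - ‖σ z - c‖ ^ 2)) - 1) ≤
      lam * (lam * (‖σ x - c‖ ^ 2 - ‖σ z - c‖ ^ 2)) := by
  have hkx : curvature σ D x ^ 2 ≤ lam ^ 2 * ‖σ x - c‖ ^ 2 := by
    rw [h x hx, hσ.norm_sub_sq c hx]
    nlinarith [sq_nonneg (lam * inner ℝ (σ x - c) (tangent σ D x))]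
  have hkz : curvature σ D z ^ 2 = lam ^ 2 * ‖σ z - c‖ ^ 2 := by
    rw [h z hz, hσ.norm_sub_sq c hz, hcrit]
    ring
  have hexp : curvature σ D x ^ 2 = curvature σ D z ^ 2 *
      Real.exp (lam * (‖σ x - c‖ ^ 2 - ‖σ z - c‖ ^ 2)) := by
    rw [h.curvature_eq_mul_exp hσ hconv hD hz hx, mul_pow, ← Real.exp_nat_mul]
    congr 2
    push_cast
    ring
  linarith

/-- Since `d < exp d - 1` for `d ≠ 0`, the inequality `mul_exp_sub_one_le` fixes the sign of the
difference `d` of the squared distances. -/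
theorem isMaxOn_norm_sub (h : IsShrinkerAbout c lam σ D) (hσ : IsRegularCurve σ D)
    (hconv : Convex ℝ D) (hD : UniqueDiffOn ℝ D) (hlam : 0 < lam) (hz : z ∈ D)
    (hcrit : inner ℝ (σ z - c) (tangent σ D z) = 0) (hk : lam ≤ curvature σ D z ^ 2) :
    IsMaxOn (fun x => ‖σ x - c‖) D z := by
  refine isMaxOn_iff.2 fun x hx => le_of_not_gt fun hlt => ?_
  have hd : 0 < lam * (‖σ x - c‖ ^ 2 - ‖σ z - c‖ ^ 2) :=
    mul_pos hlam (sub_pos.2 (pow_lt_pow_left₀ hlt (norm_nonneg _) two_ne_zero))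
  have hexp := Real.add_one_lt_exp hd.ne'
  nlinarith [h.mul_exp_sub_one_le hσ hconv hD hz hcrit hx]

theorem isMinOn_norm_sub (h : IsShrinkerAbout c lam σ D) (hσ : IsRegularCurve σ D)
    (hconv : Convex ℝ D) (hD : UniqueDiffOn ℝ D) (hlam : 0 < lam) (hz : z ∈ D)
    (hcrit : inner ℝ (σ z - c) (tangent σ D z) = 0) (hk : curvature σ D z ^ 2 ≤ lam) :
    IsMinOn (fun x => ‖σ x - c‖) D z := by
  refine isMinOn_iff.2 fun x hx => le_of_not_gt fun hlt => ?_
  have hd : lam * (‖σ x - c‖ ^ 2 - ‖σ z - c‖ ^ 2) < 0 :=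
    mul_neg_of_pos_of_neg hlam
      (sub_neg.2 (pow_lt_pow_left₀ hlt (norm_nonneg _) two_ne_zero))
  have hexp := Real.add_one_lt_exp hd.ne
  have hexp1 := Real.exp_lt_one_iff.2 hd
  nlinarith [h.mul_exp_sub_one_le hσ hconv hD hz hcrit hx]

theorem ne_center (h : IsShrinkerAbout c lam σ D) (hx : x ∈ D) (hne : curvature σ D x ≠ 0) :
    σ x ≠ c := fun hc => hne (by rw [h x hx, hc, sub_self, inner_zero_left, mul_zero])

theorem hasDerivWithinAt_direction (h : IsShrinkerAbout c lam σ D) (hσ : IsRegularCurve σ D)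
    (hlam : lam ≠ 0) (hx : x ∈ D) (hc : σ x ≠ c) :
    HasDerivWithinAt (fun x => ‖σ x - c‖⁻¹ • (σ x - c))
      ((‖vel σ D x‖ * curvature σ D x / (lam * ‖σ x - c‖ ^ 2)) •
        rot (‖σ x - c‖⁻¹ • (σ x - c))) D x := by
  refine (hasDerivWithinAt_inv_norm_smul ((hσ.hasDerivWithinAt hx).sub_const c)
    (sub_ne_zero.2 hc)).congr_deriv ?_
  have hrot : inner ℝ (vel σ D x) (rot (σ x - c)) =
      -(‖vel σ D x‖ * inner ℝ (σ x - c) (normal σ D x)) := by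
    rw [inner_rot_right, ← real_inner_smul_right, normal, ← rot_smul, hσ.norm_smul_tangent hx]
  rw [hrot, h x hx]
  congr 1
  field_simp

theorem exists_le_abs_curvature (h : IsShrinkerAbout c lam σ D) (hσ : IsRegularCurve σ D)
    (hconv : Convex ℝ D) (hD : UniqueDiffOn ℝ D) (hlam : 0 ≤ lam) (hx : x ∈ D)
    (hne : curvature σ D x ≠ 0) : ∃ δ > 0, ∀ y ∈ D, δ ≤ |curvature σ D y| := by
  refine ⟨|curvature σ D x| * Real.exp (lam / 2 * -‖σ x - c‖ ^ 2),
    mul_pos (abs_pos.2 hne) (Real.exp_pos _), fun y hy => ?_⟩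
  rw [h.curvature_eq_mul_exp hσ hconv hD hx hy, abs_mul, Real.abs_exp]
  gcongr
  linarith [sq_nonneg ‖σ y - c‖]

theorem direction_eq_of_eq_add_two_pi (h : IsShrinkerAbout c lam σ D) (hσ : IsRegularCurve σ D)
    (hconv : Convex ℝ D) (hD : UniqueDiffOn ℝ D) (hlam : lam ≠ 0)
    (hne : ∀ x ∈ D, curvature σ D x ≠ 0) {φ : ℝ → ℝ} (hφ : ∀ x ∈ D, HasDerivWithinAt φ
      (‖vel σ D x‖ * |curvature σ D x| / (lam * ‖σ x - c‖ ^ 2)) D x)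
    (hx : x ∈ D) (hy : y ∈ D) (hxy : φ y = φ x + 2 * Real.pi) :
    ‖σ x - c‖⁻¹ • (σ x - c) = ‖σ y - c‖⁻¹ • (σ y - c) := by
  set e : SignType := SignType.sign (curvature σ D x) with he
  have hsign : ∀ z ∈ D, e * |curvature σ D z| = curvature σ D z := fun z hz => by
    rw [he, ← h.sign_curvature_eq hσ hconv hD hx hz, sign_mul_abs]
  have hangle : ((e * φ y : ℝ) : Real.Angle) = (e * φ x : ℝ) := by
    rw [hxy, mul_add, Real.Angle.coe_add, add_eq_left]
    cases e <;> simp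
  exact eq_of_hasDerivWithinAt_smul_rot hconv
    (fun z hz => h.hasDerivWithinAt_direction hσ hlam hz (h.ne_center hz (hne z hz)))
    (fun z hz => ((hφ z hz).const_mul (e : ℝ)).congr_deriv (by
      linear_combination ‖vel σ D z‖ / (lam * ‖σ z - c‖ ^ 2) * hsign z hz)) hx hy hangle.symm

theorem exists_eq_add_smul_tangent (h : IsShrinkerAbout c lam σ D) (hσ : IsRegularCurve σ D)
    (hlam : lam ≠ 0) (hx : x ∈ D) (hk : curvature σ D x = 0) :
    ∃ a : ℝ, σ x = c + a • tangent σ D x := by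
  have h0 : inner ℝ (σ x - c) (normal σ D x) = 0 := by simpa [hk, hlam] using h x hx
  have hdec := eq_inner_smul_add_inner_rot_smul (hσ.norm_tangent hx) (σ x - c)
  rw [← normal, h0, zero_smul, add_zero] at hdec
  exact ⟨_, sub_eq_iff_eq_add'.1 hdec⟩

section HalfLine

theorem exists_turningAngle (h : IsShrinkerAbout c lam σ (Ici 0)) (hσ : IsCompleteHalfLine σ)
    (hlam : 0 ≤ lam) (hne : curvature σ (Ici 0) 0 ≠ 0) : ∃ θ : ℝ → ℝ,
      (∀ x ∈ Ici 0, HasDerivWithinAt θ (‖vel σ (Ici 0) x‖ * |curvature σ (Ici 0) x|) (Ici 0) x) ∧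
      Tendsto θ atTop atTop := by
  have hD := uniqueDiffOn_Ici (0 : ℝ)
  obtain ⟨δ, hδ, hle⟩ :=
    h.exists_le_abs_curvature hσ.regular (convex_Ici 0) hD hlam self_mem_Ici hne
  have hθ : ∀ x ∈ Ici (0 : ℝ), HasDerivWithinAt
      (fun y => ∫ t in (0 : ℝ)..y, ‖vel σ (Ici 0) t‖ * |curvature σ (Ici 0) t|)
      (‖vel σ (Ici 0) x‖ * |curvature σ (Ici 0) x|) (Ici 0) x := fun x =>
    hasDerivWithinAt_integral isClosed_Ici (convex_Ici 0) ((hσ.regular.continuousOn_norm_vel hD).mul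
      (hσ.regular.continuousOn_curvature hD).abs) self_mem_Ici
  refine ⟨_, hθ, tendsto_atTop_of_mul_deriv_le hδ (fun x hx => hσ.hasDerivWithinAt_arclength hx) hθ
    (fun x hx => ?_) hσ.tendsto_arclength⟩
  rw [mul_comm]
  exact mul_le_mul_of_nonneg_left (hle x hx) (norm_nonneg _)

theorem frequently_abs_curvature_sub_nonpos (h : IsShrinkerAbout c lam σ (Ici 0))
    (hσ : IsCompleteHalfLine σ) (hlam : 0 < lam) (hne : ∀ x ∈ Ici 0, curvature σ (Ici 0) x ≠ 0)
    {e : ℝ} : ∃ᶠ x in atTop, e * (|curvature σ (Ici 0) x| - √lam) ≤ 0 := by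
  have hD := uniqueDiffOn_Ici (0 : ℝ)
  obtain ⟨θ, hθ, htop⟩ := h.exists_turningAngle hσ hlam.le (hne 0 self_mem_Ici)
  refine frequently_nonpos_of_oscillation hθ
    (U := fun x => e * (lam * inner ℝ (σ x - c) (tangent σ (Ici 0) x)))
    (q := fun x => (|curvature σ (Ici 0) x| + √lam) / |curvature σ (Ici 0) x|)
    (fun x hx => ?_) (fun x hx => ?_) (fun x _ => by positivity) (fun x hx => ?_) htop
  · exact (((h.hasDerivWithinAt_abs_curvature hσ.regular hD hx (hne x hx)).sub_const _).const_mul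
      e).congr_deriv (by ring)
  · refine ((h.hasDerivWithinAt_mul_inner_sub_tangent hσ.regular hD hx).const_mul e).congr_deriv ?_
    have hk := abs_ne_zero.2 (hne x hx)
    rw [← sq_abs]
    field_simp
    linear_combination -(e * ‖vel σ (Ici 0) x‖) * Real.sq_sqrt hlam.le
  · rw [one_le_div (abs_pos.2 (hne x hx))]
    exact le_add_of_nonneg_right (Real.sqrt_nonneg _)

theorem exists_inner_sub_tangent_eq_zero (h : IsShrinkerAbout c lam σ (Ici 0))
    (hσ : IsCompleteHalfLine σ) (hlam : 0 < lam) (hne : ∀ x ∈ Ici 0, curvature σ (Ici 0) x ≠ 0)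
    {e : ℝ} (he : e ≠ 0) : ∃ z ∈ Ici 0, inner ℝ (σ z - c) (tangent σ (Ici 0) z) = 0 ∧
      0 ≤ e * (|curvature σ (Ici 0) z| - √lam) := by
  have hD := uniqueDiffOn_Ici (0 : ℝ)
  obtain ⟨z, hz, hle, hmax⟩ := exists_isLocalMax_of_frequently
    (f := fun x => e * (|curvature σ (Ici 0) x| - √lam))
    (continuousOn_const.mul ((hσ.regular.continuousOn_curvature hD).abs.sub continuousOn_const))
    (h.frequently_abs_curvature_sub_nonpos hσ hlam hne)
    ((h.frequently_abs_curvature_sub_nonpos hσ hlam hne (e := -e)).mono fun x hx => by linarith)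
  have hz0 : z ∈ Ici (0 : ℝ) := hz.le
  have hderiv := hmax.hasDerivAt_eq_zero
    ((((h.hasDerivWithinAt_abs_curvature hσ.regular hD hz0 (hne z hz0)).sub_const _).const_mul
      e).hasDerivAt (Ici_mem_nhds hz))
  refine ⟨z, hz0, ?_, hle⟩
  have hv := (hσ.regular.norm_vel_pos hz0).ne'
  simpa [he, hv, hne z hz0, hlam.ne'] using hderiv

theorem exists_isMaxOn_norm_sub (h : IsShrinkerAbout c lam σ (Ici 0))
    (hσ : IsCompleteHalfLine σ) (hlam : 0 < lam) (hne : ∀ x ∈ Ici 0, curvature σ (Ici 0) x ≠ 0) :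
    ∃ z ∈ Ici 0, IsMaxOn (fun x => ‖σ x - c‖) (Ici 0) z := by
  obtain ⟨z, hz, hcrit, hk⟩ := h.exists_inner_sub_tangent_eq_zero hσ hlam hne one_ne_zero
  refine ⟨z, hz, h.isMaxOn_norm_sub hσ.regular (convex_Ici 0) (uniqueDiffOn_Ici 0) hlam hz hcrit ?_⟩
  rw [← sq_abs, ← Real.sqrt_le_left (abs_nonneg _)]
  linarith

theorem exists_isMinOn_norm_sub (h : IsShrinkerAbout c lam σ (Ici 0))
    (hσ : IsCompleteHalfLine σ) (hlam : 0 < lam) (hne : ∀ x ∈ Ici 0, curvature σ (Ici 0) x ≠ 0) :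
    ∃ z ∈ Ici 0, IsMinOn (fun x => ‖σ x - c‖) (Ici 0) z := by
  obtain ⟨z, hz, hcrit, hk⟩ :=
    h.exists_inner_sub_tangent_eq_zero hσ hlam hne (neg_ne_zero.2 one_ne_zero)
  refine ⟨z, hz, h.isMinOn_norm_sub hσ.regular (convex_Ici 0) (uniqueDiffOn_Ici 0) hlam hz hcrit ?_⟩
  rw [← sq_abs, ← Real.le_sqrt (abs_nonneg _) hlam.le]
  linarith

theorem exists_polarAngle (h : IsShrinkerAbout c lam σ (Ici 0)) (hσ : IsCompleteHalfLine σ)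
    (hlam : 0 < lam) (hne : ∀ x ∈ Ici 0, curvature σ (Ici 0) x ≠ 0) : ∃ φ : ℝ → ℝ,
      (∀ x ∈ Ici 0, HasDerivWithinAt φ
        (‖vel σ (Ici 0) x‖ * |curvature σ (Ici 0) x| / (lam * ‖σ x - c‖ ^ 2)) (Ici 0) x) ∧
      Tendsto φ atTop atTop := by
  have hD := uniqueDiffOn_Ici (0 : ℝ)
  have hρ : ∀ x ∈ Ici (0 : ℝ), 0 < lam * ‖σ x - c‖ ^ 2 := fun x hx => mul_pos hlam
    (pow_pos (norm_pos_iff.2 (sub_ne_zero.2 (h.ne_center hx (hne x hx)))) 2)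
  obtain ⟨θ, hθ, htop⟩ := h.exists_turningAngle hσ hlam.le (hne 0 self_mem_Ici)
  obtain ⟨z, hz, hmax⟩ := h.exists_isMaxOn_norm_sub hσ hlam hne
  have hφ : ∀ x ∈ Ici (0 : ℝ), HasDerivWithinAt (fun y => ∫ t in (0 : ℝ)..y,
      ‖vel σ (Ici 0) t‖ * |curvature σ (Ici 0) t| / (lam * ‖σ t - c‖ ^ 2))
      (‖vel σ (Ici 0) x‖ * |curvature σ (Ici 0) x| / (lam * ‖σ x - c‖ ^ 2)) (Ici 0) x := fun x =>
    hasDerivWithinAt_integral isClosed_Ici (convex_Ici 0)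
      (((hσ.regular.continuousOn_norm_vel hD).mul (hσ.regular.continuousOn_curvature hD).abs).div
        (continuousOn_const.mul ((hσ.regular.1.continuousOn.sub continuousOn_const).norm.pow 2))
        fun x hx => (hρ x hx).ne') self_mem_Ici
  refine ⟨_, hφ, tendsto_atTop_of_mul_deriv_le (inv_pos.2 (hρ z hz)) hθ hφ (fun x hx => ?_) htop⟩
  rw [inv_mul_eq_div]
  have hle : ‖σ x - c‖ ≤ ‖σ z - c‖ := hmax hx
  have := hρ x hx
  gcongr

/-- The curve winds around `c` between the circles given by the extrema of `‖σ - c‖`, hence it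
meets itself after a full turn. -/
theorem not_injOn (h : IsShrinkerAbout c lam σ (Ici 0)) (hσ : IsCompleteHalfLine σ)
    (hlam : 0 < lam) (hne : ∀ x ∈ Ici 0, curvature σ (Ici 0) x ≠ 0) : ¬ InjOn σ (Ici 0) := by
  obtain ⟨φ, hφ, htop⟩ := h.exists_polarAngle hσ hlam hne
  have hc : ∀ x ∈ Ici (0 : ℝ), σ x ≠ c := fun x hx => h.ne_center hx (hne x hx)
  have hmono : StrictMonoOn φ (Ici 0) := by
    refine strictMonoOn_of_hasDerivWithinAt (convex_Ici 0) hφ fun x hx => ?_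
    have := hσ.regular.norm_vel_pos hx
    have := abs_pos.2 (hne x hx)
    have := norm_pos_iff.2 (sub_ne_zero.2 (hc x hx))
    positivity
  obtain ⟨u, hu, hmax⟩ := h.exists_isMaxOn_norm_sub hσ hlam hne
  obtain ⟨v, hv, hmin⟩ := h.exists_isMinOn_norm_sub hσ hlam hne
  obtain ⟨x, hx, y, hy, hxy, hnorm⟩ := exists_eq_add_and_eq
    (fun x hx => (hφ x hx).continuousWithinAt) hmono htop Real.two_pi_pos.le
    (ρ := fun x => ‖σ x - c‖) (hσ.regular.1.continuousOn.sub continuousOn_const).norm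
    hu hmax hv hmin
  have hdir := h.direction_eq_of_eq_add_two_pi hσ.regular (convex_Ici 0) (uniqueDiffOn_Ici 0)
    hlam.ne' hne hφ hx hy hxy
  rw [hnorm] at hdir
  have hσxy : σ x = σ y := sub_left_inj.1 (smul_right_injective Plane
    (inv_ne_zero (norm_ne_zero_iff.2 (sub_ne_zero.2 (hc x hx)))) hdir)
  intro hinj
  rw [hinj hx hy hσxy] at hxy
  linarith [Real.two_pi_pos]

end HalfLine

end IsShrinkerAbout

variable {σ : ℝ → Plane} {c : Plane} {lam x : ℝ}

theorem IsCompleteHalfLine.curvature_eq_zero (hσ : IsCompleteHalfLine σ) (hlam : 0 ≤ lam)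
    (h : IsShrinkerAbout c lam σ (Ici 0)) (hx : x ∈ Ici 0) : curvature σ (Ici 0) x = 0 := by
  rcases hlam.eq_or_lt with rfl | hpos
  · rw [h x hx, neg_zero, zero_mul]
  · by_contra hne
    refine h.not_injOn hσ hpos (fun y hy h0 => hne ?_) hσ.injective
    exact h.curvature_eq_zero_of_eq_zero hσ.regular (convex_Ici 0) (uniqueDiffOn_Ici 0) hy hx h0

theorem IsCompleteLine.isCompleteHalfLine (hσ : IsCompleteLine σ) : IsCompleteHalfLine σ where
  regular := hσ.regular.of_subset (uniqueDiffOn_Ici 0) (subset_univ _)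
  injective := hσ.injective.injOn
  length := hσ.length_right

theorem IsCompleteLine.curvature_eq_zero (hσ : IsCompleteLine σ) (hlam : 0 ≤ lam)
    (h : IsShrinkerAbout c lam σ univ) (x : ℝ) : curvature σ univ x = 0 := by
  have h0 := hσ.isCompleteHalfLine.curvature_eq_zero hlam
    (h.of_subset hσ.regular uniqueDiffOn_univ (uniqueDiffOn_Ici 0) (subset_univ _)) self_mem_Ici
  rw [hσ.regular.curvature_of_subset uniqueDiffOn_univ (uniqueDiffOn_Ici 0) (subset_univ _)
    self_mem_Ici] at h0
  exact h.curvature_eq_zero_of_eq_zero hσ.regular convex_univ uniqueDiffOn_univ (mem_univ 0)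
    (mem_univ x) h0

end Shrinkers

section SecondOrderContact

open Filter Topology Asymptotics

theorem sub_isBigO_of_hasDerivWithinAt {E : Type*} [NormedAddCommGroup E] [NormedSpace ℝ E]
    {f : ℝ → E} {f' : E} {s : Set ℝ} {x₀ : ℝ} (h : HasDerivWithinAt f f' s x₀) (hf' : f' ≠ 0) :
    (fun x => x - x₀) =O[𝓝[s] x₀] fun x => f x - f x₀ :=
  (HasDerivAtFilter.isTheta_sub h hf').isBigO_symm.comp_tendsto
    (k := fun x => (x, x₀)) (tendsto_id.prodMk (tendsto_pure.2 (Eventually.of_forall fun _ => rfl)))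

theorem isLittleO_sq_of_hasDerivWithinAt {D : Set ℝ} (hD : Convex ℝ D) {f g : ℝ → ℝ} {x₀ : ℝ}
    (hx₀ : x₀ ∈ D) (hf : ∀ x ∈ D, HasDerivWithinAt f (g x) D x) (hg : HasDerivWithinAt g 0 D x₀)
    (hg0 : g x₀ = 0) : (fun x => f x - f x₀) =o[𝓝[D] x₀] fun x => (x - x₀) ^ 2 := by
  rw [isLittleO_iff]
  intro ε hε
  have hgε := isLittleO_iff.1 hg.isLittleO hε
  simp only [hg0, smul_zero, sub_zero] at hgε
  obtain ⟨δ, hδ, hsub⟩ := Metric.mem_nhdsWithin_iff.1 hgε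
  filter_upwards [inter_mem_nhdsWithin D (Metric.ball_mem_nhds x₀ hδ)] with x hx
  have hseg : segment ℝ x₀ x ⊆ D := hD.segment_subset hx₀ hx.1
  have hball : segment ℝ x₀ x ⊆ Metric.ball x₀ δ :=
    (convex_ball x₀ δ).segment_subset (Metric.mem_ball_self hδ) hx.2
  have hbound : ∀ z ∈ segment ℝ x₀ x, ‖g z‖ ≤ ε * ‖x - x₀‖ := fun z hz => by
    refine (hsub ⟨hball hz, hseg hz⟩).trans (mul_le_mul_of_nonneg_left ?_ hε.le)
    rw [segment_eq_uIcc] at hz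
    exact abs_sub_left_of_mem_uIcc hz
  rw [norm_pow, sq, ← mul_assoc]
  exact Convex.norm_image_sub_le_of_norm_hasDerivWithin_le (fun z hz => (hf z (hseg hz)).mono hseg)
    hbound (convex_segment x₀ x) (left_mem_segment ℝ x₀ x) (right_mem_segment ℝ x₀ x)

theorem taylor_two_isLittleO {D : Set ℝ} (hD : Convex ℝ D) {f g : ℝ → ℝ} {x₀ m : ℝ}
    (hx₀ : x₀ ∈ D) (hf : ∀ x ∈ D, HasDerivWithinAt f (g x) D x) (hg : HasDerivWithinAt g m D x₀)
    (hg0 : g x₀ = 0) :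
    (fun x => f x - f x₀ - m / 2 * (x - x₀) ^ 2) =o[𝓝[D] x₀] fun x => (x - x₀) ^ 2 := by
  have hsub := fun x => (hasDerivWithinAt_id x D).sub_const x₀
  refine (isLittleO_sq_of_hasDerivWithinAt hD hx₀
    (fun x hx => (hf x hx).sub (((hsub x).pow 2).const_mul (m / 2)))
    ((hg.sub ((hsub x₀).const_mul m)).congr_of_eventuallyEq_of_mem ?_ hx₀ |>.congr_deriv ?_)
    ?_).congr_left fun x => ?_
  · refine Eventually.of_forall fun x => ?_
    simp only [Nat.cast_ofNat, id_eq, Nat.add_one_sub_one, pow_one, mul_one, Pi.sub_apply,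
      sub_right_inj]
    ring
  · simp
  · simp [hg0]
  · simp only [id_eq, Pi.pow_apply, Pi.sub_apply, sub_self, ne_eq, OfNat.ofNat_ne_zero,
      not_false_eq_true, zero_pow, mul_zero, sub_zero]
    ring

theorem eq_zero_of_const_mul_sq_isLittleO {D : Set ℝ} {x₀ m : ℝ} (hD : UniqueDiffWithinAt ℝ D x₀)
    (h : (fun x => m * (x - x₀) ^ 2) =o[𝓝[D] x₀] fun x => (x - x₀) ^ 2) : m = 0 := by
  by_contra hm
  have := accPt_principal_iff_nhdsWithin.1 hD.accPt
  refine isLittleO_irrefl' (l := 𝓝[D \ {x₀}] x₀) (Eventually.frequently ?_)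
    (((isLittleO_const_mul_left_iff hm).1 h).mono (nhdsWithin_mono _ sdiff_subset))
  filter_upwards [self_mem_nhdsWithin] with x hx
  exact norm_ne_zero_iff.2 (pow_ne_zero 2 (sub_ne_zero.2 hx.2))

theorem nhdsWithin_image_le_map {X Y : Type*} [TopologicalSpace X] [TopologicalSpace Y] [T2Space Y]
    {f : X → Y} {K : Set X} {x : X} (hK : IsCompact K) (hf : ContinuousOn f K) (hinj : InjOn f K)
    (hx : x ∈ K) : 𝓝[f '' K] (f x) ≤ map f (𝓝[K] x) := by
  have := isCompact_iff_compactSpace.1 hK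
  have hemb := (continuousOn_iff_continuous_domRestrict.1 hf).isClosedEmbedding
    (injOn_iff_injective.1 hinj)
  have hmap := hemb.isEmbedding.map_nhds_eq ⟨x, hx⟩
  rw [range_domRestrict] at hmap
  rw [nhdsWithin_eq_map_subtype_coe hx, map_map]
  exact hmap.ge

/-- At its point `p`, the set `S` has contact of second order with a curve through `p` that has the
unit normal `n` and the curvature `k` there. It allows one to compare the curvatures of curves
lying in the same set without relating their parametrizations. -/
def HasCurvatureAt (S : Set Plane) (p n : Plane) (k : ℝ) : Prop :=
  (fun q => inner ℝ (q - p) n - k / 2 * ‖q - p‖ ^ 2) =o[𝓝[S] p] fun q => ‖q - p‖ ^ 2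

variable {σ : ℝ → Plane} {D : Set ℝ} {x₀ : ℝ} {S : Set Plane} {p n : Plane} {k : ℝ}

theorem IsRegularCurve.taylor_inner_sub_norm_sq (h : IsRegularCurve σ D) (hD : UniqueDiffOn ℝ D)
    (hconv : Convex ℝ D) (hx₀ : x₀ ∈ D) (hn : inner ℝ (vel σ D x₀) n = 0) (k : ℝ) :
    (fun x => inner ℝ (σ x - σ x₀) n - k / 2 * ‖σ x - σ x₀‖ ^ 2 -
      (inner ℝ (acc σ D x₀) n - k * ‖vel σ D x₀‖ ^ 2) / 2 * (x - x₀) ^ 2) =o[𝓝[D] x₀]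
        fun x => (x - x₀) ^ 2 := by
  have hsub := fun x hx => (h.hasDerivWithinAt (x := x) hx).sub_const (σ x₀)
  have hvel := h.hasDerivWithinAt_vel hD hx₀
  have hf : ∀ x ∈ D, HasDerivWithinAt
      (fun x => inner ℝ (σ x - σ x₀) n - k / 2 * ‖σ x - σ x₀‖ ^ 2)
      (inner ℝ (vel σ D x) n - k * inner ℝ (σ x - σ x₀) (vel σ D x)) D x := fun x hx =>
    (((hsub x hx).inner ℝ (hasDerivWithinAt_const x D n)).sub
      ((hsub x hx).norm_sq.const_mul (k / 2))).congr_deriv (by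
        rw [inner_zero_right]; ring)
  have hg : HasDerivWithinAt
      (fun x => inner ℝ (vel σ D x) n - k * inner ℝ (σ x - σ x₀) (vel σ D x))
      (inner ℝ (acc σ D x₀) n - k * ‖vel σ D x₀‖ ^ 2) D x₀ :=
    ((hvel.inner ℝ (hasDerivWithinAt_const x₀ D n)).sub
      (((hsub x₀ hx₀).inner ℝ hvel).const_mul k)).congr_deriv (by simp)
  refine (taylor_two_isLittleO hconv hx₀ hf hg (by simp [hn])).congr_left fun x => ?_
  simp

theorem IsRegularCurve.hasCurvatureAt_image (h : IsRegularCurve σ D) (hD : UniqueDiffOn ℝ D)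
    (hconv : Convex ℝ D) (hcomp : IsCompact D) (hinj : InjOn σ D) (hx₀ : x₀ ∈ D) :
    HasCurvatureAt (σ '' D) (σ x₀) (normal σ D x₀) (curvature σ D x₀) := by
  refine IsLittleO.mono ?_ (nhdsWithin_image_le_map hcomp h.1.continuousOn hinj hx₀)
  rw [isLittleO_map]
  have htaylor := h.taylor_inner_sub_norm_sq hD hconv hx₀ (inner_vel_normal σ D x₀)
    (curvature σ D x₀)
  rw [h.inner_acc_normal hx₀] at htaylor
  simp only [sub_self, zero_div, zero_mul, sub_zero] at htaylor
  exact htaylor.trans_isBigO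
    ((sub_isBigO_of_hasDerivWithinAt (h.hasDerivWithinAt hx₀) (h.2 x₀ hx₀)).norm_right.pow 2)

namespace HasCurvatureAt

theorem mono {S' : Set Plane} (h : HasCurvatureAt S p n k) (hS : 𝓝[S'] p ≤ 𝓝[S] p) :
    HasCurvatureAt S' p n k :=
  IsLittleO.mono h hS

theorem inner_sub_isLittleO (h : HasCurvatureAt S p n k) :
    (fun q => inner ℝ (q - p) n) =o[𝓝[S] p] fun q => q - p := by
  have hsq : (fun q => ‖q - p‖ ^ 2) =o[𝓝[S] p] fun q => q - p := by
    refine (isLittleO_norm_pow_id one_lt_two).comp_tendsto ?_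
    exact tendsto_sub_nhds_zero_iff.2 (tendsto_id'.2 nhdsWithin_le_nhds)
  refine ((IsLittleO.trans h hsq).add (hsq.const_mul_left (k / 2))).congr_left fun q => ?_
  ring

theorem inner_deriv_eq_zero (h : HasCurvatureAt S p n k) {f : ℝ → Plane} {f' : Plane} {J : Set ℝ}
    {t₀ : ℝ} (hf : HasDerivWithinAt f f' J t₀) (hJ : UniqueDiffWithinAt ℝ J t₀)
    (hp : f t₀ = p) (hS : ∀ᶠ t in 𝓝[J] t₀, f t ∈ S) : inner ℝ f' n = 0 := by
  subst hp
  have htend : Tendsto f (𝓝[J] t₀) (𝓝[S] (f t₀)) :=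
    tendsto_nhdsWithin_iff.2 ⟨hf.continuousWithinAt, hS⟩
  have hzero : HasDerivWithinAt (fun t => inner ℝ (f t - f t₀) n) 0 J t₀ :=
    HasDerivWithinAt.of_isLittleO (by
      simpa only [Function.comp_def, sub_self, inner_zero_left, smul_zero, sub_zero] using
        (h.inner_sub_isLittleO.comp_tendsto htend).trans_isBigO hf.hasFDerivWithinAt.isBigO_sub)
  have hinner : HasDerivWithinAt (fun t => inner ℝ (f t - f t₀) n) (inner ℝ f' n) J t₀ :=
    ((hf.sub_const (f t₀)).inner ℝ (hasDerivWithinAt_const t₀ J n)).congr_deriv (by simp)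
  exact hJ.eq_deriv _ hinner hzero

theorem inner_acc (h : HasCurvatureAt S (σ x₀) n k) (hσ : IsRegularCurve σ D)
    (hD : UniqueDiffOn ℝ D) (hconv : Convex ℝ D) (hx₀ : x₀ ∈ D) (hS : ∀ᶠ x in 𝓝[D] x₀, σ x ∈ S) :
    inner ℝ (acc σ D x₀) n = k * ‖vel σ D x₀‖ ^ 2 := by
  have hder := hσ.hasDerivWithinAt hx₀
  have hn : inner ℝ (vel σ D x₀) n = 0 := h.inner_deriv_eq_zero hder (hD x₀ hx₀) rfl hS
  have htend : Tendsto σ (𝓝[D] x₀) (𝓝[S] (σ x₀)) :=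
    tendsto_nhdsWithin_iff.2 ⟨hder.continuousWithinAt, hS⟩
  have hcontact := (IsLittleO.comp_tendsto h htend).trans_isBigO
    (hder.hasFDerivWithinAt.isBigO_sub.norm_left.pow 2)
  have hdiff := hcontact.sub (hσ.taylor_inner_sub_norm_sq hD hconv hx₀ hn k)
  simp only [Function.comp_apply, sub_sub_cancel] at hdiff
  linarith [eq_zero_of_const_mul_sq_isLittleO (hD x₀ hx₀) hdiff]

theorem exists_eq_smul_normal (h : HasCurvatureAt S (σ x₀) n k) (hn : ‖n‖ = 1)
    (hσ : IsRegularCurve σ D) (hD : UniqueDiffOn ℝ D) (hconv : Convex ℝ D) (hx₀ : x₀ ∈ D)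
    (hS : ∀ᶠ x in 𝓝[D] x₀, σ x ∈ S) :
    ∃ e : ℝ, e ≠ 0 ∧ n = e • normal σ D x₀ ∧ k = e * curvature σ D x₀ := by
  have hvel : inner ℝ (vel σ D x₀) n = 0 :=
    h.inner_deriv_eq_zero (hσ.hasDerivWithinAt hx₀) (hD x₀ hx₀) rfl hS
  have hne : n = inner ℝ n (normal σ D x₀) • normal σ D x₀ := by
    have htan : inner ℝ n (tangent σ D x₀) = 0 := by
      rw [tangent, inner_smul_right, real_inner_comm, hvel, mul_zero]
    have hdecomp := eq_inner_smul_add_inner_rot_smul (hσ.norm_tangent hx₀) n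
    rwa [htan, zero_smul, zero_add] at hdecomp
  generalize inner ℝ n (normal σ D x₀) = e at hne
  subst hne
  refine ⟨e, left_ne_zero_of_smul (norm_ne_zero_iff.1 (hn ▸ one_ne_zero)), rfl, ?_⟩
  have hacc := h.inner_acc hσ hD hconv hx₀ hS
  rw [inner_smul_right, hσ.inner_acc_normal hx₀, ← mul_assoc] at hacc
  exact (mul_right_cancel₀ (pow_ne_zero 2 (hσ.norm_vel_pos hx₀).ne') hacc).symm

end HasCurvatureAt

end SecondOrderContact

section Flows

open Filter Topology

variable {T : ℝ → Set Plane} {I : Set ℝ} {r : ℝ → ℝ} {t₀ : ℝ} {p c : Plane}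

theorem timesNear_mem_nhdsWithin {ε : ℝ} (hε : 0 < ε) : timesNear I t₀ ε ∈ 𝓝[I] t₀ :=
  inter_mem_nhdsWithin I (Ioo_mem_nhds (sub_lt_self t₀ hε) (lt_add_of_pos_right t₀ hε))

theorem IsCurveFlowNear.exists_trajectory (hT : IsCurveFlowNear T I t₀ p) (ht₀ : t₀ ∈ I) :
    ∃ (n : Plane) (k : ℝ) (η : ℝ → Plane) (w : Plane), ‖n‖ = 1 ∧ HasCurvatureAt (T t₀) p n k ∧
      HasDerivWithinAt η w I t₀ ∧ η t₀ = p ∧ (∀ᶠ s in 𝓝[I] t₀, η s ∈ T s) ∧ inner ℝ w n = k := by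
  obtain ⟨U, ε, γ, hU, hpU, hε, ⟨y, hy, rfl⟩, hslice, hmove⟩ := hT
  have hyK : y ∈ Icc (-1 : ℝ) 1 := Ioo_subset_Icc_self hy
  have hJ : timesNear I t₀ ε ∈ 𝓝[I] t₀ := timesNear_mem_nhdsWithin hε
  have ht₀J : t₀ ∈ timesNear I t₀ ε := mem_of_mem_nhdsWithin ht₀ hJ
  obtain ⟨hreg, hinj, hin, -⟩ := hslice t₀ ht₀J
  obtain ⟨w, hw, hwk⟩ := hmove t₀ ht₀J y hyK
  have harc := hreg.hasCurvatureAt_image (uniqueDiffOn_Icc (by norm_num)) (convex_Icc _ _)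
    isCompact_Icc hinj hyK
  refine ⟨_, _, fun s => γ y s, w, hreg.norm_normal hyK, harc.mono ?_,
    hw.mono_of_mem_nhdsWithin hJ, rfl, ?_, hwk⟩
  · exact nhdsWithin_le_of_mem (mem_of_superset
      (inter_mem_nhdsWithin _ (hU.mem_nhds hpU)) hin)
  · filter_upwards [hJ] with s hs using (hslice s hs).2.2.2 (mem_image_of_mem _ hyK)

theorem HasCurvatureAt.inner_velocity_of_homothety {n w : Plane} {k r' : ℝ} {η : ℝ → Plane}
    (h : HasCurvatureAt (T t₀) p n k) (hI : UniqueDiffWithinAt ℝ I t₀) (hr : r t₀ ≠ 0)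
    (hr' : HasDerivWithinAt r r' I t₀)
    (hT : ∀ s ∈ I, T t₀ = AffineMap.homothety c (r t₀ / r s) '' T s)
    (hη : HasDerivWithinAt η w I t₀) (hp : η t₀ = p) (hηT : ∀ᶠ s in 𝓝[I] t₀, η s ∈ T s) :
    inner ℝ w n = r' / r t₀ * inner ℝ (p - c) n := by
  -- The trajectory rescaled to the time `t₀` stays in `T t₀`, so its velocity is tangential.
  have hρ : HasDerivWithinAt (fun s => r t₀ / r s) (-(r' / r t₀)) I t₀ :=
    ((hasDerivWithinAt_const t₀ I (r t₀)).div hr' hr).congr_deriv (by field_simp; ring)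
  have hrescaled : HasDerivWithinAt (fun s => AffineMap.homothety c (r t₀ / r s) (η s))
      (w - (r' / r t₀) • (p - c)) I t₀ := by
    refine ((hρ.smul (hη.sub_const c)).add_const c).congr_deriv ?_
    rw [div_self hr, hp]
    module
  have hstart : AffineMap.homothety c (r t₀ / r t₀) (η t₀) = p := by
    rw [div_self hr, hp, AffineMap.homothety_one, AffineMap.id_apply]
  have hmem : ∀ᶠ s in 𝓝[I] t₀, AffineMap.homothety c (r t₀ / r s) (η s) ∈ T t₀ := by
    filter_upwards [hηT, self_mem_nhdsWithin] with s hs hsI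
    rw [hT s hsI]
    exact mem_image_of_mem _ hs
  have hzero := h.inner_deriv_eq_zero hrescaled hI hstart hmem
  rwa [inner_sub_left, real_inner_smul_left, sub_eq_zero] at hzero

theorem IsCurveFlowNear.curvature_eq {σ : ℝ → Plane} {D : Set ℝ} {x₀ r' : ℝ}
    (hflow : IsCurveFlowNear T I t₀ (σ x₀)) (hI : UniqueDiffWithinAt ℝ I t₀) (ht₀ : t₀ ∈ I)
    (hr : r t₀ ≠ 0) (hr' : HasDerivWithinAt r r' I t₀)
    (hT : ∀ s ∈ I, T t₀ = AffineMap.homothety c (r t₀ / r s) '' T s)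
    (hσ : IsRegularCurve σ D) (hD : UniqueDiffOn ℝ D) (hconv : Convex ℝ D)
    (hσT : MapsTo σ D (T t₀)) (hx₀ : x₀ ∈ D) :
    curvature σ D x₀ = r' / r t₀ * inner ℝ (σ x₀ - c) (normal σ D x₀) := by
  obtain ⟨n, k, η, w, hn, hcurv, hη, hη₀, hηT, hw⟩ := hflow.exists_trajectory ht₀
  have hk := hcurv.inner_velocity_of_homothety hI hr hr' hT hη hη₀ hηT
  obtain ⟨e, he, rfl, rfl⟩ := hcurv.exists_eq_smul_normal hn hσ hD hconv hx₀
    (eventually_mem_nhdsWithin.mono fun x hx => hσT hx)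
  rw [hw, inner_smul_right, mul_left_comm] at hk
  exact mul_left_cancel₀ he hk

/-- The rate `-r' / r` at which the scale `r : I → (0, ∞)` decreases: the factor in the shrinker
equation satisfied at the time `t` by a flow that shrinks with the scale `r`. -/
noncomputable def shrinkRate (r : ℝ → ℝ) (I : Set ℝ) (t : ℝ) : ℝ := -(derivWithin r I t / r t)

theorem shrinkRate_nonneg (hr : 0 ≤ r t₀) (ha : AntitoneOn r I) : 0 ≤ shrinkRate r I t₀ :=
  neg_nonneg.2 (div_nonpos_of_nonpos_of_nonneg ha.derivWithin_nonpos hr)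

theorem exists_shrinkRate_pos (hI : I.OrdConnected) (hnt : I.Nontrivial)
    (hr : ∀ t ∈ I, 0 < r t) (hd : DifferentiableOn ℝ r I) (ha : StrictAntiOn r I) :
    ∃ t ∈ I, 0 < shrinkRate r I t := by
  by_contra! hle
  have hzero : ∀ t ∈ I, HasDerivWithinAt r 0 I t := fun t ht => by
    have hrate := le_antisymm (hle t ht) (shrinkRate_nonneg (hr t ht).le ha.antitoneOn)
    have hderiv := (div_eq_zero_iff.1 (neg_eq_zero.1 hrate)).resolve_right (hr t ht).ne'
    exact hderiv ▸ (hd t ht).hasDerivWithinAt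
  obtain ⟨a, haI, b, hbI, hab⟩ := hnt.exists_lt
  exact (ha haI hbI hab).ne' (eq_of_hasDerivWithinAt_zero hI.convex hzero haI hbI)

theorem uniqueDiffOn_of_ordConnected (hI : I.OrdConnected) (hnt : I.Nontrivial) :
    UniqueDiffOn ℝ I := by
  obtain ⟨a, ha, b, hb, hab⟩ := hnt.exists_lt
  obtain ⟨m, hm⟩ := nonempty_Ioo.2 hab
  exact uniqueDiffOn_convex hI.convex ⟨m, mem_interior.2
    ⟨Ioo a b, Ioo_subset_Icc_self.trans (hI.out ha hb), isOpen_Ioo, hm⟩⟩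

theorem isShrinkerAbout_of_isCurveFlowNear {σ : ℝ → Plane} {D E : Set ℝ}
    (hI : UniqueDiffWithinAt ℝ I t₀) (ht₀ : t₀ ∈ I) (hr : r t₀ ≠ 0)
    (hd : DifferentiableWithinAt ℝ r I t₀)
    (hT : ∀ s ∈ I, T t₀ = AffineMap.homothety c (r t₀ / r s) '' T s)
    (hσ : IsRegularCurve σ D) (hD : UniqueDiffOn ℝ D) (hconv : Convex ℝ D)
    (hσT : MapsTo σ D (T t₀)) (hED : E ⊆ D) (hDE : D ⊆ closure E)
    (hflow : ∀ x ∈ E, IsCurveFlowNear T I t₀ (σ x)) :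
    IsShrinkerAbout c (shrinkRate r I t₀) σ D := by
  refine EqOn.of_subset_closure (s := E) (fun x hx => ?_) (hσ.continuousOn_curvature hD)
    (continuousOn_const.mul ((hσ.1.continuousOn.sub continuousOn_const).inner
      (hσ.continuousOn_normal hD))) hED hDE
  rw [shrinkRate, neg_neg]
  exact (hflow x hx).curvature_eq hI ht₀ hr hd.hasDerivWithinAt hT hσ hD hconv hσT (hED hx)

end Flows

section RaysAndLines

variable {c p q v w : Plane} {ρ : ℝ}

theorem homothety_add_smul {E : Type*} [AddCommGroup E] [Module ℝ E] (c p v : E) (ρ s : ℝ) :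
    AffineMap.homothety c ρ (p + s • v) = AffineMap.homothety c ρ p + (ρ * s) • v := by
  simp only [AffineMap.homothety_apply, vsub_eq_sub, vadd_eq_add]
  module

theorem eq_of_homothety_apply_eq_self {E : Type*} [AddCommGroup E] [Module ℝ E] {c p : E} {ρ : ℝ}
    (hρ : ρ ≠ 1) (h : AffineMap.homothety c ρ p = p) : p = c := by
  rw [AffineMap.homothety_apply, vsub_eq_sub, vadd_eq_add, ← eq_sub_iff_add_eq] at h
  by_contra hne
  exact hρ (smul_left_injective ℝ (sub_ne_zero.2 hne) (h.trans (one_smul ℝ _).symm))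

theorem homothety_image_ray (hρ : 0 < ρ) (c p v : Plane) :
    AffineMap.homothety c ρ '' ray p v = ray (AffineMap.homothety c ρ p) v := by
  have hIci : (fun s => ρ * s) '' Ici 0 = Ici 0 := by rw [image_mul_left_Ici hρ, mul_zero]
  simp only [ray]
  nth_rw 2 [← hIci]
  simp only [image_image, homothety_add_smul]

theorem homothety_image_straightLine (hρ : ρ ≠ 0) (c p v : Plane) :
    AffineMap.homothety c ρ '' straightLine p v = straightLine (AffineMap.homothety c ρ p) v := by
  rw [straightLine, ← range_comp, straightLine,
    ← (mul_left_surjective₀ hρ).range_comp fun s : ℝ => AffineMap.homothety c ρ p + s • v]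
  exact congrArg range (funext (homothety_add_smul c p v ρ))

theorem straightLine_add_smul (c v : Plane) (a : ℝ) :
    straightLine (c + a • v) v = straightLine c v := by
  rw [straightLine, straightLine,
    ← (Equiv.addLeft a).surjective.range_comp fun s : ℝ => c + s • v]
  simp only [Function.comp_def, Equiv.coe_addLeft, add_smul, add_assoc]

theorem start_mem_ray (p v : Plane) : p ∈ ray p v := ⟨0, self_mem_Ici, by simp⟩

theorem ray_start_unique (h : ray p w = ray q v) : p = q := by
  obtain ⟨a, ha, hp⟩ : p ∈ ray q v := h ▸ start_mem_ray p w
  obtain ⟨b, hb, hq⟩ : q ∈ ray p w := h ▸ start_mem_ray q v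
  -- The reflection of `p` in `q` lies on the half-line as well.
  obtain ⟨d, hd, hr⟩ : p + (2 * b) • w ∈ ray q v :=
    h ▸ ⟨2 * b, mul_nonneg zero_le_two (mem_Ici.1 hb), rfl⟩
  simp only [mem_Ici] at ha hd hp hq hr
  have hsum : (a + d) • v = 0 := by
    linear_combination (norm := module) hp + hr + (2 : ℝ) • hq
  rcases smul_eq_zero.1 hsum with h0 | h0
  · rw [← hp, (add_eq_zero_iff_of_nonneg ha hd).1 h0 |>.1, zero_smul, add_zero]
  · rw [← hp, h0, smul_zero, add_zero]

end RaysAndLines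

section BalancedVectors

variable {E : Type*} [NormedAddCommGroup E] [InnerProductSpace ℝ E]

theorem inner_eq_neg_half_of_add_add_eq_zero {a b d : E} (ha : ‖a‖ = 1) (hb : ‖b‖ = 1)
    (hd : ‖d‖ = 1) (h : a + b + d = 0) : inner ℝ a b = -(1 / 2 : ℝ) := by
  have hsq := norm_add_sq_real a b
  rw [eq_neg_of_add_eq_zero_left h, norm_neg, ha, hb, hd] at hsq
  linarith

theorem inner_eq_neg_half_of_sum_eq_zero {v : Fin 3 → E} (hv : ∀ i, ‖v i‖ = 1)
    (hsum : ∑ i, v i = 0) {i j : Fin 3} (hij : i ≠ j) : inner ℝ (v i) (v j) = -(1 / 2 : ℝ) := by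
  obtain ⟨m, hm⟩ : ∃ m, Function.Bijective ![i, j, m] := by revert i j; decide
  have hsum' := hm.sum_comp v
  rw [Fin.sum_univ_three, hsum] at hsum'
  exact inner_eq_neg_half_of_add_add_eq_zero (hv i) (hv j) (hv m) hsum'

theorem not_forall_eq_smul_of_sum_eq_zero {v : Fin 3 → E} (hv : ∀ i, ‖v i‖ = 1)
    (hsum : ∑ i, v i = 0) (u : E) : ¬ ∀ i, ∃ a : ℝ, v i = a • u := by
  intro h
  obtain ⟨a, ha⟩ := h 0
  obtain ⟨b, hb⟩ := h 1
  have hsq : (inner ℝ (v 0) (v 1) : ℝ) ^ 2 = ‖v 0‖ ^ 2 * ‖v 1‖ ^ 2 := by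
    simp only [← real_inner_self_eq_norm_sq, ha, hb, real_inner_smul_left, real_inner_smul_right]
    ring
  rw [inner_eq_neg_half_of_sum_eq_zero hv hsum zero_ne_one, hv, hv] at hsq
  norm_num at hsq

variable {v w : Fin 3 → Plane} {c p : Plane}

theorem angles120_of_sum_eq_zero (hv : ∀ i, ‖v i‖ = 1) (hsum : ∑ i, v i = 0) : Angles120 v := by
  refine ⟨hv, fun i j hij => ?_⟩
  have hcos : Real.cos (2 * Real.pi / 3) = -(1 / 2) := by
    rw [show 2 * Real.pi / 3 = Real.pi - Real.pi / 3 by ring, Real.cos_pi_sub,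
      Real.cos_pi_div_three]
  rw [InnerProductGeometry.angle, inner_eq_neg_half_of_sum_eq_zero hv hsum hij, hv, hv, mul_one,
    div_one, ← hcos, Real.arccos_cos (by positivity) (by linarith [Real.pi_pos])]

theorem exists_eq_smul_of_add_smul_mem_rays (hv : ∀ i, ‖v i‖ = 1) (hsum : ∑ i, v i = 0)
    {j : Fin 3} {a : ℝ} (ha : 0 < a) {u : Plane} (hu : ‖u‖ = 1)
    (h : c + a • v j + (a / 2) • u ∈ ⋃ m, ray c (v m)) : ∃ b : ℝ, u = b • v j := by
  obtain ⟨m, b, hb, hq⟩ := mem_iUnion.1 h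
  have hbm : b • v m = a • v j + (a / 2) • u := add_left_cancel (hq.trans (add_assoc _ _ _))
  obtain rfl : m = j := by
    by_contra hne
    have hinner := congrArg (fun z => (inner ℝ z (v j) : ℝ)) hbm
    simp only [inner_add_left, real_inner_smul_left, real_inner_self_eq_norm_sq, hv,
      inner_eq_neg_half_of_sum_eq_zero hv hsum hne] at hinner
    have hbound := neg_le_of_abs_le (abs_real_inner_le_norm u (v j))
    rw [hv, hu] at hbound
    nlinarith [mem_Ici.1 hb]
  refine ⟨(a / 2)⁻¹ * (b - a), ?_⟩
  rw [mul_smul, sub_smul, hbm, add_sub_cancel_left, inv_smul_smul₀ (by positivity)]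

theorem vertex_unique (hv : ∀ i, ‖v i‖ = 1) (hvsum : ∑ i, v i = 0) (hw : ∀ i, ‖w i‖ = 1)
    (hwsum : ∑ i, w i = 0) (hsub : ∀ i, ray p (w i) ⊆ ⋃ j, ray c (v j)) : p = c := by
  obtain ⟨j, a, ha, rfl⟩ := mem_iUnion.1 (hsub 0 (start_mem_ray p (w 0)))
  rcases (mem_Ici.1 ha).eq_or_lt with rfl | hpos
  · simp
  · refine (not_forall_eq_smul_of_sum_eq_zero hw hwsum (v j) fun i => ?_).elim
    exact exists_eq_smul_of_add_smul_mem_rays hv hvsum hpos (hw i)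
      (hsub i ⟨a / 2, (half_pos hpos).le, rfl⟩)

end BalancedVectors

section Rigidity

/-- Three complete embedded half-lines with a common end point at which they form angles of 120
degrees. Unlike the edges of a complete embedded triod, they may cross each other elsewhere. -/
structure IsBalancedTriod (σ : Fin 3 → ℝ → Plane) : Prop where
  edge : ∀ i, IsCompleteHalfLine (σ i)
  common : ∀ i j, σ i 0 = σ j 0
  angles : ∑ i, tangent (σ i) (Ici 0) 0 = 0

theorem IsCompleteTriod.isBalancedTriod {σ : Fin 3 → ℝ → Plane} (h : IsCompleteTriod σ) :
    IsBalancedTriod σ :=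
  ⟨fun i => ⟨h.triod.regular i, h.triod.injective i, h.length i⟩, h.triod.common, h.triod.angles⟩

variable {c : Plane} {lam : ℝ}

theorem IsCompleteHalfLine.norm_tangent_zero {σ : ℝ → Plane} (h : IsCompleteHalfLine σ) :
    ‖tangent σ (Ici 0) 0‖ = 1 :=
  h.regular.norm_tangent self_mem_Ici

theorem IsCompleteHalfLine.exists_eq_add_smul {σ : ℝ → Plane} (hσ : IsCompleteHalfLine σ)
    (hlam : 0 < lam) (h : IsShrinkerAbout c lam σ (Ici 0)) :
    ∃ a : ℝ, σ 0 = c + a • tangent σ (Ici 0) 0 :=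
  h.exists_eq_add_smul_tangent hσ.regular hlam.ne' self_mem_Ici
    (hσ.curvature_eq_zero hlam.le h self_mem_Ici)

theorem IsCompleteLine.range_eq_straightLine_of_isShrinkerAbout {σ : ℝ → Plane}
    (hσ : IsCompleteLine σ) (hlam : 0 < lam) (h : IsShrinkerAbout c lam σ univ) :
    range σ = straightLine c (tangent σ univ 0) := by
  have hk := hσ.curvature_eq_zero hlam.le h
  obtain ⟨a, ha⟩ := h.exists_eq_add_smul_tangent hσ.regular hlam.ne' (mem_univ 0) (hk 0)
  rw [hσ.range_eq_straightLine hk, ha, straightLine_add_smul]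

namespace IsBalancedTriod

variable {σ : Fin 3 → ℝ → Plane}

theorem norm_tangent (h : IsBalancedTriod σ) (i : Fin 3) : ‖tangent (σ i) (Ici 0) 0‖ = 1 :=
  (h.edge i).norm_tangent_zero

theorem angles120 (h : IsBalancedTriod σ) : Angles120 fun i => tangent (σ i) (Ici 0) 0 :=
  angles120_of_sum_eq_zero h.norm_tangent h.angles

theorem start_eq (hσ : IsBalancedTriod σ) (hlam : 0 < lam)
    (h : ∀ i, IsShrinkerAbout c lam (σ i) (Ici 0)) (i : Fin 3) : σ i 0 = c := by
  by_contra hne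
  refine not_forall_eq_smul_of_sum_eq_zero hσ.norm_tangent hσ.angles (σ i 0 - c) fun j => ?_
  obtain ⟨a, ha⟩ := (hσ.edge j).exists_eq_add_smul hlam (h j)
  rw [hσ.common j i, ← sub_eq_iff_eq_add'] at ha
  have ha₀ : a ≠ 0 := left_ne_zero_of_smul (ha ▸ sub_ne_zero.2 hne)
  exact ⟨a⁻¹, by rw [ha, inv_smul_smul₀ ha₀]⟩

theorem image_eq_ray (hσ : IsBalancedTriod σ) (hlam : 0 < lam)
    (h : ∀ i, IsShrinkerAbout c lam (σ i) (Ici 0)) (i : Fin 3) :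
    σ i '' Ici 0 = ray c (tangent (σ i) (Ici 0) 0) := by
  rw [(hσ.edge i).image_eq_ray fun x hx => (hσ.edge i).curvature_eq_zero hlam.le (h i) hx,
    hσ.start_eq hlam h i]

end IsBalancedTriod

variable {I : Set ℝ}

theorem triodFlow_rigidity (hI : I.OrdConnected) (hnt : I.Nontrivial) (σ : ℝ → Fin 3 → ℝ → Plane)
    (hσ : ∀ t ∈ I, IsBalancedTriod (σ t))
    (hflow : ∀ t ∈ I, ∀ i, ∀ x > 0, IsCurveFlowNear (fun s => triodSet (σ s)) I t (σ t i x))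
    (hs : ShrinksHomothetically (fun t => triodSet (σ t)) I c) :
    (∃ v : Fin 3 → Plane, Angles120 v ∧ ∀ t ∈ I, triodSet (σ t) = ⋃ i, ray c (v i)) ∧
      (∀ t ∈ I, ∀ i, σ t i 0 = c) ∧
      ∀ t ∈ I, ∀ i, ∀ x ∈ Ici (0 : ℝ), curvature (σ t i) (Ici 0) x = 0 := by
  obtain ⟨r, hr, hd, ha, hT⟩ := hs
  beta_reduce at hT
  have hsh : ∀ t ∈ I, ∀ i, IsShrinkerAbout c (shrinkRate r I t) (σ t i) (Ici 0) := fun t ht i =>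
    isShrinkerAbout_of_isCurveFlowNear (uniqueDiffOn_of_ordConnected hI hnt t ht) ht (hr t ht).ne'
      (hd t ht) (fun s hs => hT s hs t ht) ((hσ t ht).edge i).regular (uniqueDiffOn_Ici 0)
      (convex_Ici 0) (fun x hx => mem_iUnion.2 ⟨i, mem_image_of_mem _ hx⟩) Ioi_subset_Ici_self
      (closure_Ioi 0).ge (hflow t ht i)
  have hk : ∀ t ∈ I, ∀ i, ∀ x ∈ Ici (0 : ℝ), curvature (σ t i) (Ici 0) x = 0 :=
    fun t ht i x hx => ((hσ t ht).edge i).curvature_eq_zero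
      (shrinkRate_nonneg (hr t ht).le ha.antitoneOn) (hsh t ht i) hx
  obtain ⟨t₁, ht₁, hpos⟩ := exists_shrinkRate_pos hI hnt hr hd ha
  have hset : ∀ t ∈ I, triodSet (σ t) = ⋃ i, ray c (tangent (σ t₁ i) (Ici 0) 0) := fun t ht => by
    rw [hT t₁ ht₁ t ht, triodSet, image_iUnion]
    refine iUnion_congr fun i => ?_
    rw [(hσ t₁ ht₁).image_eq_ray hpos (hsh t₁ ht₁),
      homothety_image_ray (div_pos (hr t ht) (hr t₁ ht₁)), AffineMap.homothety_apply_same]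
  refine ⟨⟨_, (hσ t₁ ht₁).angles120, hset⟩, fun t ht i => ?_, hk⟩
  refine vertex_unique (hσ t₁ ht₁).norm_tangent (hσ t₁ ht₁).angles (hσ t ht).norm_tangent
    (hσ t ht).angles fun j => ?_
  rw [← hset t ht, (hσ t ht).common i j, ← ((hσ t ht).edge j).image_eq_ray (hk t ht j)]
  exact subset_iUnion (fun j => σ t j '' Ici 0) j

theorem lineFlow_rigidity (hI : I.OrdConnected) (hnt : I.Nontrivial) (σ : ℝ → ℝ → Plane)
    (hσ : ∀ t ∈ I, IsCompleteLine (σ t))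
    (hflow : ∀ t ∈ I, ∀ x, IsCurveFlowNear (fun s => range (σ s)) I t (σ t x))
    (hs : ShrinksHomothetically (fun t => range (σ t)) I c) :
    (∃ v : Plane, ‖v‖ = 1 ∧ ∀ t ∈ I, range (σ t) = straightLine c v) ∧
      ∀ t ∈ I, ∀ x, curvature (σ t) univ x = 0 := by
  obtain ⟨r, hr, hd, ha, hT⟩ := hs
  beta_reduce at hT
  have hsh : ∀ t ∈ I, IsShrinkerAbout c (shrinkRate r I t) (σ t) univ := fun t ht =>
    isShrinkerAbout_of_isCurveFlowNear (uniqueDiffOn_of_ordConnected hI hnt t ht) ht (hr t ht).ne'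
      (hd t ht) (fun s hs => hT s hs t ht) (hσ t ht).regular uniqueDiffOn_univ convex_univ
      (fun x _ => mem_range_self x) subset_rfl subset_closure (fun x _ => hflow t ht x)
  obtain ⟨t₁, ht₁, hpos⟩ := exists_shrinkRate_pos hI hnt hr hd ha
  refine ⟨⟨_, (hσ t₁ ht₁).regular.norm_tangent (mem_univ 0), fun t ht => ?_⟩, fun t ht =>
    (hσ t ht).curvature_eq_zero (shrinkRate_nonneg (hr t ht).le ha.antitoneOn) (hsh t ht)⟩
  rw [hT t₁ ht₁ t ht, (hσ t₁ ht₁).range_eq_straightLine_of_isShrinkerAbout hpos (hsh t₁ ht₁),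
    homothety_image_straightLine (div_pos (hr t ht) (hr t₁ ht₁)).ne',
    AffineMap.homothety_apply_same]

theorem homothety_start_eq {σ σ' : ℝ → Plane} {ρ : ℝ} (hρ : 0 < ρ) (hσ : IsCompleteHalfLine σ)
    (hσ' : IsCompleteHalfLine σ') (hk : ∀ x ∈ Ici (0 : ℝ), curvature σ (Ici 0) x = 0)
    (hk' : ∀ x ∈ Ici (0 : ℝ), curvature σ' (Ici 0) x = 0)
    (himg : σ' '' Ici 0 = AffineMap.homothety c ρ '' (σ '' Ici 0)) :
    σ' 0 = AffineMap.homothety c ρ (σ 0) := by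
  rw [hσ.image_eq_ray hk, hσ'.image_eq_ray hk', homothety_image_ray hρ] at himg
  exact ray_start_unique himg

theorem halfLineFlow_rigidity (hI : I.OrdConnected) (hnt : I.Nontrivial) (σ : ℝ → ℝ → Plane)
    (hσ : ∀ t ∈ I, IsCompleteHalfLine (σ t))
    (hflow : ∀ t ∈ I, ∀ x > 0, IsCurveFlowNear (fun s => σ s '' Ici 0) I t (σ t x))
    (hs : ShrinksHomothetically (fun t => σ t '' Ici 0) I c) :
    (∃ (v : Plane) (a : ℝ → ℝ), ‖v‖ = 1 ∧
      ∀ t ∈ I, σ t 0 = c + a t • v ∧ σ t '' Ici 0 = ray (σ t 0) v) ∧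
    (∀ t ∈ I, ∀ x ∈ Ici (0 : ℝ), curvature (σ t) (Ici 0) x = 0) ∧
    ((∀ s ∈ I, ∀ t ∈ I, σ s 0 = σ t 0) →
      ∃ v : Plane, ‖v‖ = 1 ∧ ∀ t ∈ I, σ t '' Ici 0 = ray c v) := by
  obtain ⟨r, hr, hd, ha, hT⟩ := hs
  beta_reduce at hT
  have hsh : ∀ t ∈ I, IsShrinkerAbout c (shrinkRate r I t) (σ t) (Ici 0) := fun t ht =>
    isShrinkerAbout_of_isCurveFlowNear (uniqueDiffOn_of_ordConnected hI hnt t ht) ht (hr t ht).ne'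
      (hd t ht) (fun s hs => hT s hs t ht) (hσ t ht).regular (uniqueDiffOn_Ici 0) (convex_Ici 0)
      (fun x hx => mem_image_of_mem _ hx) Ioi_subset_Ici_self (closure_Ioi 0).ge (hflow t ht)
  have hk : ∀ t ∈ I, ∀ x ∈ Ici (0 : ℝ), curvature (σ t) (Ici 0) x = 0 := fun t ht x hx =>
    (hσ t ht).curvature_eq_zero (shrinkRate_nonneg (hr t ht).le ha.antitoneOn) (hsh t ht) hx
  have hstart : ∀ s ∈ I, ∀ t ∈ I, σ t 0 = AffineMap.homothety c (r t / r s) (σ s 0) :=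
    fun s hs t ht => homothety_start_eq (div_pos (hr t ht) (hr s hs)) (hσ s hs) (hσ t ht)
      (hk s hs) (hk t ht) (hT s hs t ht)
  obtain ⟨t₁, ht₁, hpos⟩ := exists_shrinkRate_pos hI hnt hr hd ha
  obtain ⟨a, ha₁⟩ := (hσ t₁ ht₁).exists_eq_add_smul hpos (hsh t₁ ht₁)
  have himg : ∀ t ∈ I, σ t '' Ici 0 = ray (σ t 0) (tangent (σ t₁) (Ici 0) 0) := fun t ht => by
    rw [hT t₁ ht₁ t ht, (hσ t₁ ht₁).image_eq_ray (hk t₁ ht₁),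
      homothety_image_ray (div_pos (hr t ht) (hr t₁ ht₁)), hstart t₁ ht₁ t ht]
  refine ⟨⟨_, fun t => r t / r t₁ * a, (hσ t₁ ht₁).norm_tangent_zero, fun t ht =>
    ⟨?_, himg t ht⟩⟩, hk, fun hfix => ⟨_, (hσ t₁ ht₁).norm_tangent_zero, fun t ht => ?_⟩⟩
  · rw [hstart t₁ ht₁ t ht, ha₁, homothety_add_smul, AffineMap.homothety_apply_same]
  · obtain ⟨s, hs, u, hu, hsu⟩ := hnt.exists_lt
    have hfixed : σ s 0 = c := eq_of_homothety_apply_eq_self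
      (ρ := r u / r s) (mt (div_eq_one_iff_eq (hr s hs).ne').1 (ha hs hu hsu).ne)
      ((hstart s hs u hu).symm.trans (hfix u hu s hs))
    rw [himg t ht, hfix t ht s hs, hfixed]

end Rigidity

theorem mainTheorem8_general :
    (∀ (c : Plane) (lam : ℝ), 0 < lam →
      (∀ σ : Fin 3 → ℝ → Plane, IsBalancedTriod σ →
        (∀ i, IsShrinkerAbout c lam (σ i) (Ici 0)) →
        (∀ i, σ i 0 = c) ∧
        (∃ v : Fin 3 → Plane, Angles120 v ∧ ∀ i, σ i '' Ici 0 = ray c (v i)) ∧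
        ∀ i, ∀ x ∈ Ici (0 : ℝ), curvature (σ i) (Ici 0) x = 0) ∧
      (∀ σ : ℝ → Plane, IsCompleteLine σ → IsShrinkerAbout c lam σ univ →
        (∃ v : Plane, ‖v‖ = 1 ∧ range σ = straightLine c v) ∧
        ∀ x, curvature σ univ x = 0) ∧
      (∀ σ : ℝ → Plane, IsCompleteHalfLine σ → IsShrinkerAbout c lam σ (Ici 0) →
        (∃ (v : Plane) (a : ℝ), ‖v‖ = 1 ∧ σ 0 = c + a • v ∧ σ '' Ici 0 = ray (σ 0) v) ∧
        ∀ x ∈ Ici (0 : ℝ), curvature σ (Ici 0) x = 0)) ∧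
    (∀ (I : Set ℝ) (c : Plane), I.OrdConnected → I.Nontrivial →
      (∀ σ : ℝ → Fin 3 → ℝ → Plane, (∀ t ∈ I, IsBalancedTriod (σ t)) →
        (∀ t ∈ I, ∀ i, ∀ x > 0, IsCurveFlowNear (fun s => triodSet (σ s)) I t (σ t i x)) →
        ShrinksHomothetically (fun t => triodSet (σ t)) I c →
        (∃ v : Fin 3 → Plane, Angles120 v ∧
          ∀ t ∈ I, triodSet (σ t) = ⋃ i, ray c (v i)) ∧
        (∀ t ∈ I, ∀ i, σ t i 0 = c) ∧
        ∀ t ∈ I, ∀ i, ∀ x ∈ Ici (0 : ℝ), curvature (σ t i) (Ici 0) x = 0) ∧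
      (∀ σ : ℝ → ℝ → Plane, (∀ t ∈ I, IsCompleteLine (σ t)) →
        (∀ t ∈ I, ∀ x, IsCurveFlowNear (fun s => range (σ s)) I t (σ t x)) →
        ShrinksHomothetically (fun t => range (σ t)) I c →
        (∃ v : Plane, ‖v‖ = 1 ∧ ∀ t ∈ I, range (σ t) = straightLine c v) ∧
        ∀ t ∈ I, ∀ x, curvature (σ t) univ x = 0) ∧
      (∀ σ : ℝ → ℝ → Plane, (∀ t ∈ I, IsCompleteHalfLine (σ t)) →
        (∀ t ∈ I, ∀ x > 0, IsCurveFlowNear (fun s => σ s '' Ici 0) I t (σ t x)) →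
        ShrinksHomothetically (fun t => σ t '' Ici 0) I c →
        (∃ (v : Plane) (a : ℝ → ℝ), ‖v‖ = 1 ∧
          ∀ t ∈ I, σ t 0 = c + a t • v ∧ σ t '' Ici 0 = ray (σ t 0) v) ∧
        (∀ t ∈ I, ∀ x ∈ Ici (0 : ℝ), curvature (σ t) (Ici 0) x = 0) ∧
        ((∀ s ∈ I, ∀ t ∈ I, σ s 0 = σ t 0) →
          ∃ v : Plane, ‖v‖ = 1 ∧ ∀ t ∈ I, σ t '' Ici 0 = ray c v))) := by
  refine ⟨fun c lam hlam => ⟨fun σ hσ h => ?_, fun σ hσ h => ?_, fun σ hσ h => ?_⟩,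
    fun I c hI hnt =>
      ⟨triodFlow_rigidity hI hnt, lineFlow_rigidity hI hnt, halfLineFlow_rigidity hI hnt⟩⟩
  · exact ⟨hσ.start_eq hlam h, ⟨_, hσ.angles120, hσ.image_eq_ray hlam h⟩,
      fun i x hx => (hσ.edge i).curvature_eq_zero hlam.le (h i) hx⟩
  · exact ⟨⟨_, hσ.regular.norm_tangent (mem_univ 0),
      hσ.range_eq_straightLine_of_isShrinkerAbout hlam h⟩, hσ.curvature_eq_zero hlam.le h⟩
  · obtain ⟨a, ha⟩ := hσ.exists_eq_add_smul hlam h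
    have hk : ∀ x ∈ Ici (0 : ℝ), curvature σ (Ici 0) x = 0 :=
      fun x hx => hσ.curvature_eq_zero hlam.le h hx
    exact ⟨⟨_, a, hσ.norm_tangent_zero, ha, hσ.image_eq_ray hk⟩, hk⟩

theorem mainTheorem8 :
    -- complete embedded triods without end points with `k = -⟨x | ν⟩`
    (∀ σ : Fin 3 → ℝ → Plane, IsCompleteTriod σ → (∀ i, IsShrinker (σ i) (Ici 0)) →
      (∀ i, σ i 0 = 0) ∧
      (∃ v : Fin 3 → Plane, Angles120 v ∧ ∀ i, σ i '' Ici 0 = ray 0 (v i)) ∧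
      ∀ i, ∀ x ∈ Ici (0 : ℝ), curvature (σ i) (Ici 0) x = 0) ∧
    -- complete embedded curves without end points with `k = -⟨x | ν⟩`
    (∀ σ : ℝ → Plane, IsCompleteLine σ → IsShrinker σ univ →
      (∃ v : Plane, ‖v‖ = 1 ∧ range σ = straightLine 0 v) ∧
      ∀ x, curvature σ univ x = 0) ∧
    -- complete embedded curves with one end point with `k = -⟨x | ν⟩`
    (∀ σ : ℝ → Plane, IsCompleteHalfLine σ → IsShrinker σ (Ici 0) →
      (∃ (v : Plane) (a : ℝ), ‖v‖ = 1 ∧ σ 0 = a • v ∧ σ '' Ici 0 = ray (σ 0) v) ∧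
      ∀ x ∈ Ici (0 : ℝ), curvature σ (Ici 0) x = 0) ∧
    -- homothetically shrinking flows
    (∀ (I : Set ℝ) (c : Plane), I.OrdConnected → I.Nontrivial →
      (∀ σ : ℝ → Fin 3 → ℝ → Plane, IsTriodFlow σ I →
        ShrinksHomothetically (fun t => triodSet (σ t)) I c →
        (∃ v : Fin 3 → Plane, Angles120 v ∧
          ∀ t ∈ I, triodSet (σ t) = ⋃ i, ray c (v i)) ∧
        (∀ t ∈ I, ∀ i, σ t i 0 = c) ∧
        ∀ t ∈ I, ∀ i, ∀ x ∈ Ici (0 : ℝ), curvature (σ t i) (Ici 0) x = 0) ∧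
      (∀ σ : ℝ → ℝ → Plane, IsLineFlow σ I →
        ShrinksHomothetically (fun t => range (σ t)) I c →
        (∃ v : Plane, ‖v‖ = 1 ∧ ∀ t ∈ I, range (σ t) = straightLine c v) ∧
        ∀ t ∈ I, ∀ x, curvature (σ t) univ x = 0) ∧
      (∀ σ : ℝ → ℝ → Plane, IsHalfLineFlow σ I →
        ShrinksHomothetically (fun t => σ t '' Ici 0) I c →
        (∃ (v : Plane) (a : ℝ → ℝ), ‖v‖ = 1 ∧
          ∀ t ∈ I, σ t 0 = c + a t • v ∧ σ t '' Ici 0 = ray (σ t 0) v) ∧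
        (∀ t ∈ I, ∀ x ∈ Ici (0 : ℝ), curvature (σ t) (Ici 0) x = 0) ∧
        -- if moreover the end point is kept fixed, the half-line starts at `c` and is static
        ((∀ s ∈ I, ∀ t ∈ I, σ s 0 = σ t 0) →
          ∃ v : Plane, ‖v‖ = 1 ∧ ∀ t ∈ I, σ t '' Ici 0 = ray c v))) := by
  obtain ⟨hshrinker, hflow⟩ := mainTheorem8_general
  obtain ⟨htriod, hline, hhalf⟩ := hshrinker 0 1 one_pos
  refine ⟨fun σ hσ h => htriod σ hσ.isBalancedTriod fun i => (h i).isShrinkerAbout,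
    fun σ hσ h => hline σ hσ h.isShrinkerAbout,
    fun σ hσ h => by simpa only [zero_add] using hhalf σ hσ h.isShrinkerAbout,
    fun I c hI hnt => ?_⟩
  obtain ⟨htriods, hlines, hhalves⟩ := hflow I c hI hnt
  exact ⟨fun σ hσ => htriods σ (fun t ht => (hσ.slice t ht).isBalancedTriod) hσ.edges,
    fun σ hσ => hlines σ hσ.slice hσ.points, fun σ hσ => hhalves σ hσ.slice hσ.points⟩
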